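/- Let $k$ be an algebraically closed field of arbitrary characteristic (characteristic $2$ included), and let $R=\bigoplus_{i\ge 0}R_i$ be a standard graded $k$-algebra, that is, a commutative graded algebra with $R_0=k$ and $\dim_k R_1<\infty$ that is generated by $R_1$. Assume that $R$ is quadratic, i.e. $R\cong Q/I$ as graded algebras with $Q$ a polynomial ring over $k$ in finitely many variables of degree $1$ and $I$ an ideal generated by homogeneous polynomials of degree $2$, and assume that $R$ is Artinian. Let $\mathfrak m=R_{\ge 1}$. For an ordered $k$-basis $x_1,\dots,x_e$ of $R_1$ (equivalently, a minimal generating set of $\mathfrak m$ by linear forms) consider the following conditions, where a condition that mentions $x_i$ includes the requirement $i\le e$. 1. $\mathfrak m^2=x_1\mathfrak m$ and $x_1^2=0$. 2. $\mathfrak m^2=x_1\mathfrak m+x_2\mathfrak m$, $x_1^2=0$, $x_2^2\in x_1\mathfrak m$, and $x_1\mathfrak m=(x_1x_j)$, where $j=2$ if $x_1x_2\neq 0$ and $j=3$ if $x_1x_2=0$. 3. $\mathfrak m^2=x_1\mathfrak m+x_2\mathfrak m$, $x_1^2=0=x_1x_2$, and $x_2^2\in x_1\mathfrak m$. 4. $\mathfrak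 m^2=x_1\mathfrak m+(x_2x_3)$, $x_1^2=0=x_1x_3$, and $x_2^2\in x_1\mathfrak m$. 5. $\mathfrak m^2=x_1\mathfrak m+(x_2x_3)$, $x_1^2=0=x_1x_4$, $x_2^2\in x_1\mathfrak m$, $x_2x_4\in x_1\mathfrak m$, and $x_4^2-x_2x_3\in x_1\mathfrak m$. 6. $\mathfrak m^2=x_1\mathfrak m+x_2\mathfrak m$, $x_1^2=0=x_1x_3$, $x_2^2\in x_1\mathfrak m$, $x_3\mathfrak m=(x_3^2)$, and $x_1\mathfrak m=(x_1x_j,x_3^2)$, where $j=4$ if $x_1x_2\in x_3\mathfrak m$ and $j=2$ if $x_1x_2\notin x_3\mathfrak m$. 7. $\mathfrak m^2=x_1\mathfrak m+x_2\mathfrak m+x_3\mathfrak m$, $x_1^2=0$, $x_2^2\in x_1\mathfrak m$, $x_3^2\in(x_1,x_2)\mathfrak m$, and there are $i\neq 1$ and $j\notin\{1,2\}$ such that $x_1\mathfrak m=(x_1x_i)$, $(x_1,x_2)\mathfrak m=(x_1x_i,x_2x_j)$ and $x_2x_j\notin(x_1x_i)$. 8. $\mathfrak m^2=x_1\mathfrak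 m=x_2\mathfrak m$ and $x_1x_2=0$. A condition is said to hold up to a change of variables if it holds for some ordered $k$-basis of $R_1$. Then: (a) If $\dim_k R_2=1$, then condition (1) holds up to a change of variables. (b) If $\dim_k R_2=2$, then condition (1) or condition (2) holds up to a change of variables. (c) If $\dim_k R_2=3$, then one of the conditions (1)–(8) holds up to a change of variables, or $R$ is a trivial fiber extension of a complete intersection of embedding dimension $3$; that is, there are finitely many (possibly zero) linear forms $u_1,\dots,u_n\in R_1$ with $u_iR_1=0$ for all $i$ such that, as graded algebras, $R/(u_1,\dots,u_n)\cong k[X_1,X_2,X_3]/(f_1,\dots,f_d)$ for some regular sequence $f_1,\dots,f_d$ of homogeneous polynomials of degree at least $2$. -/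

import Mathlib

universe u v

namespace QuadAlg

section Graded

variable {k : Type u} {R : Type v} [Field k] [CommRing R] [Algebra k R]

/-- `R = ⨁ 𝒜 i` is a standard graded `k`-algebra: `R₀ = k`, `R₁` is finite dimensional,
and `R` is generated by `R₁` as a `k`-algebra. -/
structure IsStandardGraded (𝒜 : ℕ → Submodule k R) [GradedAlgebra 𝒜] : Prop where
  nontrivial : Nontrivial R
  zero_eq : 𝒜 0 = 1
  finite_one : Module.Finite k (𝒜 1)
  generated : Algebra.adjoin k (𝒜 1 : Set R) = ⊤

/-- `R` is quadratic: `R = Q / I` as graded algebras, where `Q` is a polynomial ring in finitely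
many variables of degree `1` (mapping to the linear forms `x i`) and the ideal `I` is generated by
homogeneous polynomials of degree `2`. -/
def IsQuadratic (𝒜 : ℕ → Submodule k R) : Prop :=
  ∃ (e : ℕ) (x : Fin e → R) (S : Set (MvPolynomial (Fin e) k)),
    (∀ i, x i ∈ 𝒜 1) ∧
    Function.Surjective (MvPolynomial.aeval x : MvPolynomial (Fin e) k →ₐ[k] R) ∧
    (∀ f ∈ S, f.IsHomogeneous 2) ∧
    RingHom.ker (MvPolynomial.aeval x : MvPolynomial (Fin e) k →ₐ[k] R) = Ideal.span S

/-- The maximal homogeneous ideal `R_{≥ 1}`. -/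
def maxIdeal (𝒜 : ℕ → Submodule k R) [GradedAlgebra 𝒜] : Ideal R :=
  (HomogeneousIdeal.irrelevant 𝒜).toIdeal

/-- The property `C` of a sequence of variables holds up to a (linear) change of variables: it is
satisfied by some ordered `k`-basis of `R₁`. -/
def UpToChange (𝒜 : ℕ → Submodule k R) (C : ∀ e : ℕ, (Fin e → R) → Prop) : Prop :=
  ∃ (e : ℕ) (b : Module.Basis (Fin e) k (𝒜 1)), C e (fun i => (b i : R))

/-- `J` is generated by finitely many linear forms that annihilate `R₁`, that is, `R` is a
trivial fiber extension of `R ⧸ J`. (The family may be empty, and then `J = 0`.) -/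
def IsTrivialFiberIdeal (𝒜 : ℕ → Submodule k R) (J : Ideal R) : Prop :=
  ∃ (n : ℕ) (w : Fin n → R),
    (∀ i, w i ∈ 𝒜 1) ∧ (∀ i, ∀ r ∈ 𝒜 1, w i * r = 0) ∧ J = Ideal.span (Set.range w)

/-- The grading of `R ⧸ J` by the images of the graded components of `R`. -/
def quotientGrading (𝒜 : ℕ → Submodule k R) (J : Ideal R) : ℕ → Submodule k (R ⧸ J) :=
  fun d => (𝒜 d).map (Ideal.Quotient.mkₐ k J).toLinearMap

/-- `R` is a (graded) complete intersection of embedding dimension `e`: `R = Q / (f₁, …, f_d)` with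
`Q` the polynomial ring in `e` variables of degree `1`, and `f₁, …, f_d` a `Q`-regular sequence of
forms of degree at least `2`. -/
def IsCompleteIntersection (𝒜 : ℕ → Submodule k R) (e : ℕ) : Prop :=
  ∃ (x : Fin e → R) (fs : List (MvPolynomial (Fin e) k)),
    (∀ i, x i ∈ 𝒜 1) ∧
    Function.Surjective (MvPolynomial.aeval x : MvPolynomial (Fin e) k →ₐ[k] R) ∧
    (∀ f ∈ fs, ∃ d, 2 ≤ d ∧ f.IsHomogeneous d) ∧
    RingTheory.Sequence.IsRegular (MvPolynomial (Fin e) k) fs ∧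
    RingHom.ker (MvPolynomial.aeval x : MvPolynomial (Fin e) k →ₐ[k] R) = Ideal.ofList fs

/-- `R` is a trivial fiber extension of a complete intersection of embedding dimension `e`. -/
def IsTrivialFiberExtensionOfCI (𝒜 : ℕ → Submodule k R) (e : ℕ) : Prop :=
  ∃ J : Ideal R, IsTrivialFiberIdeal 𝒜 J ∧ IsCompleteIntersection (quotientGrading 𝒜 J) e

end Graded

/- The eight conditions on a sequence of variables. The mathematical `x₁, x₂, …, x_e` are
`x 0, x 1, …, x (e - 1)`; a condition that mentions `x_i` includes the requirement `i ≤ e`. -/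
section Conditions

variable {R : Type v} [CommRing R]

def Cond1 (m : Ideal R) (e : ℕ) (x : Fin e → R) : Prop :=
  ∃ h1 : 0 < e,
    let x₁ := x ⟨0, h1⟩
    m ^ 2 = Ideal.span {x₁} * m ∧ x₁ ^ 2 = 0

def Cond2 (m : Ideal R) (e : ℕ) (x : Fin e → R) : Prop :=
  ∃ (h1 : 0 < e) (h2 : 1 < e),
    let x₁ := x ⟨0, h1⟩
    let x₂ := x ⟨1, h2⟩
    m ^ 2 = Ideal.span {x₁} * m + Ideal.span {x₂} * m ∧
    x₁ ^ 2 = 0 ∧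
    x₂ ^ 2 ∈ Ideal.span {x₁} * m ∧
    (x₁ * x₂ ≠ 0 → Ideal.span {x₁} * m = Ideal.span {x₁ * x₂}) ∧
    (x₁ * x₂ = 0 → ∃ h3 : 2 < e, Ideal.span {x₁} * m = Ideal.span {x₁ * x ⟨2, h3⟩})

def Cond3 (m : Ideal R) (e : ℕ) (x : Fin e → R) : Prop :=
  ∃ (h1 : 0 < e) (h2 : 1 < e),
    let x₁ := x ⟨0, h1⟩
    let x₂ := x ⟨1, h2⟩
    m ^ 2 = Ideal.span {x₁} * m + Ideal.span {x₂} * m ∧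
    x₁ ^ 2 = 0 ∧ x₁ * x₂ = 0 ∧
    x₂ ^ 2 ∈ Ideal.span {x₁} * m

def Cond4 (m : Ideal R) (e : ℕ) (x : Fin e → R) : Prop :=
  ∃ (h1 : 0 < e) (h2 : 1 < e) (h3 : 2 < e),
    let x₁ := x ⟨0, h1⟩
    let x₂ := x ⟨1, h2⟩
    let x₃ := x ⟨2, h3⟩
    m ^ 2 = Ideal.span {x₁} * m + Ideal.span {x₂ * x₃} ∧
    x₁ ^ 2 = 0 ∧ x₁ * x₃ = 0 ∧
    x₂ ^ 2 ∈ Ideal.span {x₁} * m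

def Cond5 (m : Ideal R) (e : ℕ) (x : Fin e → R) : Prop :=
  ∃ (h1 : 0 < e) (h2 : 1 < e) (h3 : 2 < e) (h4 : 3 < e),
    let x₁ := x ⟨0, h1⟩
    let x₂ := x ⟨1, h2⟩
    let x₃ := x ⟨2, h3⟩
    let x₄ := x ⟨3, h4⟩
    m ^ 2 = Ideal.span {x₁} * m + Ideal.span {x₂ * x₃} ∧
    x₁ ^ 2 = 0 ∧ x₁ * x₄ = 0 ∧
    x₂ ^ 2 ∈ Ideal.span {x₁} * m ∧
    x₂ * x₄ ∈ Ideal.span {x₁} * m ∧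
    x₄ ^ 2 - x₂ * x₃ ∈ Ideal.span {x₁} * m

def Cond6 (m : Ideal R) (e : ℕ) (x : Fin e → R) : Prop :=
  ∃ (h1 : 0 < e) (h2 : 1 < e) (h3 : 2 < e),
    let x₁ := x ⟨0, h1⟩
    let x₂ := x ⟨1, h2⟩
    let x₃ := x ⟨2, h3⟩
    m ^ 2 = Ideal.span {x₁} * m + Ideal.span {x₂} * m ∧
    x₁ ^ 2 = 0 ∧ x₁ * x₃ = 0 ∧
    x₂ ^ 2 ∈ Ideal.span {x₁} * m ∧
    Ideal.span {x₃} * m = Ideal.span {x₃ ^ 2} ∧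
    (x₁ * x₂ ∈ Ideal.span {x₃} * m →
      ∃ h4 : 3 < e, Ideal.span {x₁} * m = Ideal.span {x₁ * x ⟨3, h4⟩, x₃ ^ 2}) ∧
    (x₁ * x₂ ∉ Ideal.span {x₃} * m →
      Ideal.span {x₁} * m = Ideal.span {x₁ * x₂, x₃ ^ 2})

def Cond7 (m : Ideal R) (e : ℕ) (x : Fin e → R) : Prop :=
  ∃ (h1 : 0 < e) (h2 : 1 < e) (h3 : 2 < e),
    let x₁ := x ⟨0, h1⟩
    let x₂ := x ⟨1, h2⟩
    let x₃ := x ⟨2, h3⟩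
    m ^ 2 = Ideal.span {x₁} * m + Ideal.span {x₂} * m + Ideal.span {x₃} * m ∧
    x₁ ^ 2 = 0 ∧
    x₂ ^ 2 ∈ Ideal.span {x₁} * m ∧
    x₃ ^ 2 ∈ Ideal.span {x₁, x₂} * m ∧
    ∃ i j : Fin e, i ≠ ⟨0, h1⟩ ∧ j ≠ ⟨0, h1⟩ ∧ j ≠ ⟨1, h2⟩ ∧
      Ideal.span {x₁} * m = Ideal.span {x₁ * x i} ∧
      Ideal.span {x₁, x₂} * m = Ideal.span {x₁ * x i, x₂ * x j} ∧
      x₂ * x j ∉ Ideal.span {x₁ * x i}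

def Cond8 (m : Ideal R) (e : ℕ) (x : Fin e → R) : Prop :=
  ∃ (h1 : 0 < e) (h2 : 1 < e),
    let x₁ := x ⟨0, h1⟩
    let x₂ := x ⟨1, h2⟩
    m ^ 2 = Ideal.span {x₁} * m ∧ m ^ 2 = Ideal.span {x₂} * m ∧ x₁ * x₂ = 0

end Conditions

end QuadAlg

/-! Everything is read off the multiplication `B : R₁ × R₁ → R₂` (`linMul`) and its radical `ker B`.
For a quadratic algebra, a pair (φ, ψ) of functionals on R₁ and R₂ with ψ(xy) = φ(x)φ(y) extends to
an algebra map R → k; in the Artinian case linear forms are nilpotent, so φ = 0. Hence no form ψ ∘ B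
with ψ ≠ 0 is the square of a linear functional. `Admissible` records this, and
`Admissible.exists_isotropic` turns it into a vector isotropic for ψ ∘ B but outside its radical, in
every characteristic. The second tool is `exists_null`: dim R₂ quadrics in more than dim R₂
variables have a nontrivial common zero, hence there are non-radical x with x² = 0. The conditions
then arise from the rank of such an x, choosing further variables isotropic modulo xR₁
(`Admissible.form1_or_form2`, `Admissible.form2_or_form7`, `Admissible.form345_or_annihilator`,
`Admissible.form6_of_rank_one`).

For dim R₂ = 3 the codimension of the radical is at least 3 (`Admissible.three_le_codim`). If it is
3, then R modulo its radical linear forms is given by three quadrics in three variables; a nonzero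
common zero would violate admissibility, so they form a regular sequence
(`IsQuadratic.isTrivialFiberExtensionOfCI`). If it is at least 4 and conditions (1)–(7) fail, every
non-radical x with x² = 0 is a pivot (`IsPivot`), with a form ψ ∘ B whose radical is the annihilator
of x. If ψ is nonzero on some square, condition (8) follows (`IsPivot.form8`). If ψ ∘ B is
alternating for all pivots, the characteristic is 2, squaring is additive, and enough elements of
square zero can be produced to reach a contradiction (`Admissible.false_of_alternating`). -/

namespace QuadAlg
-- Common zeros of few polynomials, by Krull's height theorem.
section CommonZeros
open MvPolynomial

variable {k : Type u} [Field k]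

/-- The polynomials that vanish after the first `j` variables are set to zero. -/
noncomputable def coordIdeal (k : Type u) [Field k] (n j : ℕ) : Ideal (MvPolynomial (Fin n) k) :=
  RingHom.ker (aeval (fun i : Fin n => if (i : ℕ) < j then 0 else X i) :
    MvPolynomial (Fin n) k →ₐ[k] MvPolynomial (Fin n) k)

instance coordIdeal_isPrime (n j : ℕ) : (coordIdeal k n j).IsPrime :=
  RingHom.ker_isPrime _

theorem coordIdeal_lt_succ {n j : ℕ} (hj : j < n) : coordIdeal k n j < coordIdeal k n (j + 1) := by
  refine lt_of_le_of_ne ?_ ?_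
  · intro p hp
    have hcomp : (aeval (fun i : Fin n => if (i : ℕ) < j + 1 then 0 else X i) :
        MvPolynomial (Fin n) k →ₐ[k] MvPolynomial (Fin n) k) =
        (aeval (fun i : Fin n => if (i : ℕ) < j + 1 then 0 else X i)).comp
          (aeval (fun i : Fin n => if (i : ℕ) < j then 0 else X i)) := by
      ext i : 1
      by_cases h : (i : ℕ) < j
      · simp [h, h.le]
      · simp [h]
    have hp' : aeval (fun i : Fin n => if (i : ℕ) < j then (0 : MvPolynomial (Fin n) k) else X i) p
        = 0 := hp
    change aeval _ p = 0
    rw [hcomp, AlgHom.comp_apply, hp', map_zero]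
  · intro h
    have h1 : (X ⟨j, hj⟩ : MvPolynomial (Fin n) k) ∈ coordIdeal k n (j + 1) := by
      change aeval _ _ = _
      simp
    rw [← h] at h1
    change aeval _ _ = _ at h1
    simp at h1

theorem le_height_coordIdeal {n j : ℕ} (hj : j ≤ n) : (j : ℕ∞) ≤ (coordIdeal k n j).height := by
  induction j with
  | zero => simp
  | succ j ih =>
    have h := Ideal.height_add_one_le_of_lt_of_isPrime (coordIdeal_lt_succ (k := k) (j := j) hj)
    push_cast
    exact (add_le_add_left (ih (by omega)) 1).trans h

/-- Fewer than `n` polynomials in `n` variables that vanish at the origin have a second common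
zero over an algebraically closed field. -/
theorem exists_ne_zero_common_zero [IsAlgClosed k] {n : ℕ} {ι : Type*} [Fintype ι]
    (hn : Fintype.card ι < n) (f : ι → MvPolynomial (Fin n) k)
    (hf : ∀ i, constantCoeff (f i) = 0) :
    ∃ x : Fin n → k, x ≠ 0 ∧ ∀ i, aeval x (f i) = 0 := by
  have hI : Ideal.span (Set.range f) ≤ coordIdeal k n n := by
    rw [Ideal.span_le]
    rintro _ ⟨i, rfl⟩
    change aeval _ _ = _
    have : (fun i : Fin n => if (i : ℕ) < n then (0 : MvPolynomial (Fin n) k) else X i) =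
        fun _ => 0 := by
      ext1 i; simp
    rw [this, aeval_zero', hf, map_zero]
  obtain ⟨P, hP, hle⟩ := Ideal.exists_minimalPrimes_le hI
  have hPp : P.IsPrime := hP.1.1
  -- By Krull, `P` has height at most the number of polynomials, which is less than n, while the
  -- ideal of the origin has height at least n.
  have hlt : P < coordIdeal k n n := by
    refine lt_of_le_of_ne hle fun h => ?_
    have h1 := Ideal.height_le_spanRank_toENat_of_mem_minimalPrimes _ _ hP
    have h2 : (Submodule.spanRank (Ideal.span (Set.range f))) ≤ (Fintype.card ι : ℕ) := by
      refine (Submodule.spanRank_span_le_card _).trans ?_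
      have := Cardinal.mk_range_le_lift (f := f)
      simpa using this
    have h3 := Cardinal.toENat_le_natCast.2 h2
    have h4 := (h ▸ le_height_coordIdeal (k := k) le_rfl).trans (h1.trans h3)
    norm_cast at h4
    omega
  -- `g` vanishes at the origin but, by the Nullstellensatz, not on the whole zero locus of `P`; a
  -- zero of `P` where `g` does not vanish is the required point.
  obtain ⟨g, hg, hgP⟩ := SetLike.exists_of_lt hlt
  rw [← IsPrime.vanishingIdeal_zeroLocus (K := k) P] at hgP
  rw [mem_vanishingIdeal_iff] at hgP
  push Not at hgP
  obtain ⟨x, hx, hgx⟩ := hgP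
  refine ⟨x, ?_, fun i => hx _ (hP.1.2 (Ideal.subset_span ⟨i, rfl⟩))⟩
  rintro rfl
  apply hgx
  have hg' : aeval (fun i : Fin n => if (i : ℕ) < n then (0 : MvPolynomial (Fin n) k) else X i) g
      = 0 := hg
  have : (fun i : Fin n => if (i : ℕ) < n then (0 : MvPolynomial (Fin n) k) else X i) =
      fun _ => 0 := by
    ext1 i; simp
  rw [this, aeval_zero'] at hg'
  rw [aeval_zero]
  simpa using hg'

end CommonZeros
-- Admissible bilinear maps: isotropic vectors and the codimension of the radical.
section Bilinear
open Module LinearMap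

variable {k : Type u} [Field k]

theorem exists_quadratic_root [IsAlgClosed k] {a : k} (ha : a ≠ 0) (b c : k) :
    ∃ t, a * t ^ 2 + b * t + c = 0 := by
  obtain ⟨t, ht⟩ := IsAlgClosed.exists_root
    (Polynomial.C a * Polynomial.X ^ 2 + Polynomial.C b * Polynomial.X + Polynomial.C c)
    (by rw [Polynomial.degree_quadratic ha]; decide)
  exact ⟨t, by simpa [Polynomial.IsRoot] using ht⟩

variable {V W : Type*} [AddCommGroup V] [Module k V] [AddCommGroup W] [Module k W]

/-- A symmetric bilinear map whose values span the target, and which has no functional of the form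
`(x, y) ↦ φ x * φ y` factoring through it: the multiplication `R₁ × R₁ → R₂` of an Artinian
quadratic algebra. -/
structure Admissible (B : V →ₗ[k] V →ₗ[k] W) : Prop where
  symm : ∀ x y, B x y = B y x
  eq_zero_of_forall : ∀ ψ : W →ₗ[k] k, (∀ x y, ψ (B x y) = 0) → ψ = 0
  eq_zero_of_mul : ∀ (φ : V →ₗ[k] k) (ψ : W →ₗ[k] k), (∀ x y, ψ (B x y) = φ x * φ y) → φ = 0

theorem Admissible.compr₂ {B : V →ₗ[k] V →ₗ[k] W} (hB : Admissible B)
    {W' : Type*} [AddCommGroup W'] [Module k W'] (p : W →ₗ[k] W') (hp : Function.Surjective p) :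
    Admissible (B.compr₂ p) where
  symm x y := by simp [hB.symm x y]
  eq_zero_of_forall ψ h := by
    have h0 := hB.eq_zero_of_forall (ψ ∘ₗ p) h
    ext w
    obtain ⟨w, rfl⟩ := hp w
    exact congr($h0 w)
  eq_zero_of_mul φ ψ h := hB.eq_zero_of_mul φ (ψ ∘ₗ p) h

/-- If the radical of `B` has codimension greater than the dimension of the target, then some
vector outside of the radical has square zero. -/
theorem exists_null [IsAlgClosed k] [FiniteDimensional k V] [FiniteDimensional k W]
    (B : V →ₗ[k] V →ₗ[k] W) (h : finrank k W + finrank k (ker B) < finrank k V) :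
    ∃ x, B x x = 0 ∧ B x ≠ 0 := by
  obtain ⟨C, hC⟩ := Submodule.exists_isCompl (ker B)
  have hdim := Submodule.finrank_add_eq_of_isCompl hC
  let c := finBasis k C
  let w := finBasis k W
  let f : Fin (finrank k W) → MvPolynomial (Fin (finrank k C)) k := fun l =>
    ∑ i, ∑ j, MvPolynomial.C (w.repr (B (c i) (c j)) l) * (MvPolynomial.X i * MvPolynomial.X j)
  obtain ⟨x, hx0, hx⟩ := exists_ne_zero_common_zero (by simp; omega) f (by simp [f])
  let y : C := c.equivFun.symm x
  have hy0 : y ≠ 0 := fun h => hx0 (c.equivFun.symm.map_eq_zero_iff.1 h)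
  have hy : (y : V) = ∑ i, x i • (c i : V) := by
    simp [y, Basis.equivFun_symm_apply]
  refine ⟨y, ?_, fun h0 => hy0 ?_⟩
  · apply w.repr.injective
    ext l
    have := hx l
    simp only [f, map_sum, map_mul, MvPolynomial.aeval_X, MvPolynomial.aeval_C,
      Algebra.algebraMap_self, RingHom.id_apply] at this
    rw [hy]
    simp only [map_sum, map_smul, LinearMap.sum_apply, LinearMap.smul_apply, Finsupp.coe_finsetSum,
      Finset.sum_apply, Finsupp.coe_smul, Pi.smul_apply, smul_eq_mul, map_zero, Finsupp.coe_zero,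
      Pi.zero_apply]
    rw [← this, Finset.sum_comm]
    refine Finset.sum_congr rfl fun i _ => ?_
    rw [Finset.mul_sum]
    refine Finset.sum_congr rfl fun j _ => ?_
    ring
  · have : (y : V) ∈ ker B ⊓ C := ⟨h0, y.2⟩
    rw [hC.inf_eq_bot] at this
    simpa using this

variable {B : V →ₗ[k] V →ₗ[k] W}

/-- If every isotropic vector were in the radical of ψ ∘ B, pick `a` with ψ(a²) ≠ 0. Each `x` has a
translate `x + t a` that is isotropic, hence radical, so the form has rank one and equals the square
of `ψ(a ·) / s` with `s² = ψ(a²)`. No division by 2 occurs. -/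
theorem Admissible.exists_isotropic [IsAlgClosed k] (hB : Admissible B) {ψ : W →ₗ[k] k}
    (hψ : ψ ≠ 0) : ∃ y v, ψ (B y y) = 0 ∧ ψ (B y v) ≠ 0 := by
  by_contra! H
  obtain ⟨a, v₀, hav⟩ : ∃ a v₀, ψ (B a v₀) ≠ 0 := by
    by_contra! h
    exact hψ (hB.eq_zero_of_forall ψ h)
  have haa : ψ (B a a) ≠ 0 := fun h => hav (H a v₀ h)
  obtain ⟨s, hs⟩ := IsAlgClosed.exists_pow_nat_eq (ψ (B a a)) (n := 2) two_pos
  have hs0 : s ≠ 0 := by rintro rfl; simp at hs; exact haa hs.symm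
  have h0 := hB.eq_zero_of_mul (s⁻¹ • (ψ ∘ₗ B a)) ψ fun x y => by
    obtain ⟨t, ht⟩ := exists_quadratic_root haa (2 * ψ (B a x)) (ψ (B x x))
    have hiso : ψ (B (x + t • a) (x + t • a)) = 0 := by
      rw [← ht]
      simp [hB.symm x a]
      ring
    have h1 := H _ a hiso
    have h2 := H _ y hiso
    simp only [map_add, map_smul, LinearMap.add_apply, LinearMap.smul_apply, smul_eq_mul,
      hB.symm x a] at h1 h2
    simp only [LinearMap.smul_apply, LinearMap.comp_apply, smul_eq_mul]
    rw [← hs] at h1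
    field_simp
    linear_combination s ^ 2 * h2 - ψ (B a y) * h1
  have h1 : s⁻¹ * ψ (B a a) = 0 := congr($h0 a)
  exact (mul_ne_zero (inv_ne_zero hs0) haa) h1

/-- ψ ∘ B has rank at least two: with `y` isotropic and ψ(yv) ≠ 0, the Gram determinant of `y, v` is
-ψ(yv)², so pairing with `y` and `v` maps V onto k². -/
theorem Admissible.finrank_ker_add_two_le [IsAlgClosed k] [FiniteDimensional k V]
    (hB : Admissible B) {ψ : W →ₗ[k] k} (hψ : ψ ≠ 0) :
    finrank k (ker (B.compr₂ ψ)) + 2 ≤ finrank k V := by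
  obtain ⟨y, v, hyy, hyv⟩ := hB.exists_isotropic hψ
  let L : V →ₗ[k] k × k := (ψ ∘ₗ B y).prod (ψ ∘ₗ B v)
  have hL : range L = ⊤ := by
    rw [range_eq_top]
    rintro ⟨p, q⟩
    refine ⟨((q - p / ψ (B y v) * ψ (B v v)) / ψ (B y v)) • y + (p / ψ (B y v)) • v, ?_⟩
    ext
    · simp [L, hyy, hyv]
    · simp [L, hB.symm v y, hyv]
  have h1 := finrank_range_add_finrank_ker L
  rw [hL, finrank_top] at h1
  have h2 : ker (B.compr₂ ψ) ≤ ker L := by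
    intro w hw
    have hw' : ∀ z, ψ (B w z) = 0 := fun z => congr($hw z)
    simp [L, hB.symm _ w, hw']
  have h3 := Submodule.finrank_mono h2
  simp at h1
  omega

/-- A functional ψ ≠ 0 that vanishes on the image of `B c` puts `c` into the radical of ψ ∘ B, which
is thus strictly larger than that of `B` and still has codimension at least two. -/
theorem Admissible.finrank_ker_add_three_le [IsAlgClosed k] [FiniteDimensional k V]
    (hB : Admissible B) {c : V} (hc : B c ≠ 0) (hr : range (B c) ≠ ⊤) :
    finrank k (ker B) + 3 ≤ finrank k V := by
  obtain ⟨ψ, hψ, hle⟩ := Submodule.exists_le_ker_of_lt_top _ (lt_top_iff_ne_top.2 hr)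
  have h1 := hB.finrank_ker_add_two_le hψ
  have h2 : ker B < ker (B.compr₂ ψ) := by
    refine lt_of_le_of_ne (fun x hx => ?_) fun h => hc ?_
    · ext v
      simp [mem_ker.1 hx]
    · have : c ∈ ker (B.compr₂ ψ) := by
        ext v
        exact hle ⟨v, rfl⟩
      rw [← h] at this
      exact this
  have h3 := Submodule.finrank_lt_finrank_of_lt h2
  omega

/-- In a pencil of maps between spaces of the same dimension some member is not injective. -/
theorem exists_pencil_not_injective [IsAlgClosed k] {C : Type*} [AddCommGroup C] [Module k C]
    [FiniteDimensional k C] [Nontrivial C] [FiniteDimensional k W] (F G : C →ₗ[k] W)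
    (h : finrank k C = finrank k W) :
    ∃ (s t : k) (c : C), (s ≠ 0 ∨ t ≠ 0) ∧ c ≠ 0 ∧ s • F c + t • G c = 0 := by
  by_cases hG : Function.Injective G
  · let e := LinearMap.linearEquivOfInjective G hG h
    obtain ⟨μ, hμ⟩ := Module.End.exists_eigenvalue (e.symm.toLinearMap ∘ₗ F : C →ₗ[k] C)
    obtain ⟨c, hc⟩ := hμ.exists_hasEigenvector
    have h1 := hc.apply_eq_smul
    have h2 : F c = μ • G c := by
      have := congrArg e h1
      simpa [e] using this
    exact ⟨1, -μ, c, .inl one_ne_zero, hc.2, by simp [h2]⟩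
  · rw [injective_iff_map_eq_zero] at hG
    push Not at hG
    obtain ⟨c, hc, hc0⟩ := hG
    exact ⟨0, 1, c, .inr one_ne_zero, hc0, by simp [hc]⟩

/-- In codimension at most two every nonzero `B c` is onto, so dim W = 2 and `B` restricts to a
pencil of maps between planes. A singular member of the pencil has rank below two without being
zero, a contradiction. -/
theorem Admissible.three_le_codim [IsAlgClosed k] [FiniteDimensional k V] [FiniteDimensional k W]
    (hB : Admissible B) (hW : 2 ≤ finrank k W) : finrank k (ker B) + 3 ≤ finrank k V := by
  by_contra! hlt
  have hsurj : ∀ c, B c ≠ 0 → range (B c) = ⊤ := fun c hc => by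
    by_contra hr
    have := hB.finrank_ker_add_three_le hc hr
    omega
  have hle : ∀ c, ker B ≤ ker (B c) := fun c x hx => by
    rw [mem_ker, hB.symm, mem_ker.1 hx, LinearMap.zero_apply]
  have hnt : Nontrivial W := Module.nontrivial_of_finrank_pos (R := k) (by omega)
  obtain ⟨ψ, hψ, -⟩ := Submodule.exists_le_ker_of_lt_top (⊥ : Submodule k W) bot_lt_top
  obtain ⟨a, v, -, hav⟩ := hB.exists_isotropic hψ
  have ha : B a ≠ 0 := fun h => hav (by simp [h])
  have h1 := finrank_range_add_finrank_ker (B a)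
  rw [hsurj a ha, finrank_top] at h1
  have h2 := Submodule.finrank_mono (hle a)
  obtain ⟨C, hC⟩ := Submodule.exists_isCompl (ker B)
  have hdim := Submodule.finrank_add_eq_of_isCompl hC
  have hC2 : finrank k C = finrank k W := by omega
  have hC2' : finrank k C = 2 := by omega
  have : Nontrivial C := Module.nontrivial_of_finrank_pos (R := k) (by omega)
  let b := finBasisOfFinrankEq k C hC2'
  have hbij : ∀ c ∈ C, c ≠ 0 → c ∉ ker B := fun c hc hc0 h => hc0 <| by
    have : c ∈ ker B ⊓ C := ⟨h, hc⟩
    rw [hC.inf_eq_bot] at this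
    simpa using this
  obtain ⟨s, t, c, hst, hc0, hc⟩ := exists_pencil_not_injective
    (B (b 0) ∘ₗ C.subtype) (B (b 1) ∘ₗ C.subtype) hC2
  have hd0 : s • b 0 + t • b 1 ≠ 0 := fun h => by
    have h01 : LinearIndependent k ![b 0, b 1] := by
      have := b.linearIndependent
      convert this using 1
      ext i; fin_cases i <;> rfl
    have := LinearIndependent.pair_iff.1 h01 s t h
    tauto
  set d : V := ((s • b 0 + t • b 1 : C) : V) with hd
  have hdB : B d ≠ 0 := hbij d (Subtype.coe_prop _) (by rw [hd]; exact fun h => hd0 (Subtype.ext h))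
  have h3 := finrank_range_add_finrank_ker (B d)
  rw [hsurj d hdB, finrank_top] at h3
  have hlt : ker B < ker (B d) := by
    refine lt_of_le_of_ne (hle d) fun h => hbij c c.2 (by simpa using hc0) ?_
    rw [h]
    simpa [hd] using hc
  have h4 := Submodule.finrank_lt_finrank_of_lt hlt
  omega

theorem Admissible.exists_range_eq_top_of_finrank_eq_one [IsAlgClosed k] [FiniteDimensional k W]
    (hB : Admissible B) (hW : finrank k W = 1) : ∃ x, B x x = 0 ∧ range (B x) = ⊤ := by
  have hnt : Nontrivial W := Module.nontrivial_of_finrank_pos (R := k) (by omega)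
  obtain ⟨ψ, hψ, -⟩ := Submodule.exists_le_ker_of_lt_top (⊥ : Submodule k W) bot_lt_top
  have hker : ker ψ = ⊥ := by
    have h1 := Module.Dual.finrank_ker_add_one_of_ne_zero hψ
    exact Submodule.finrank_eq_zero.1 (by omega)
  obtain ⟨y, v, hyy, hyv⟩ := hB.exists_isotropic hψ
  refine ⟨y, by rwa [← mem_ker, hker, Submodule.mem_bot] at hyy, ?_⟩
  refine Submodule.eq_top_of_finrank_eq ?_
  have h0 : B y v ≠ 0 := fun h => hyv (by simp [h])
  have : range (B y) ≠ ⊥ := fun h => h0 <| by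
    have : B y v ∈ range (B y) := ⟨v, rfl⟩
    simpa [h] using this
  have h1 := Submodule.one_le_finrank_iff.2 this
  have h2 := Submodule.finrank_le (range (B y))
  omega

end Bilinear
-- The eight normal forms for bilinear maps, and how vectors of square zero lead to them.
section Forms
open Module LinearMap

variable {k : Type u} [Field k]
variable {V W : Type*} [AddCommGroup V] [Module k V] [AddCommGroup W] [Module k W]

theorem linearIndependent_triple {x y z : V}
    (h : ∀ s t r : k, s • x + t • y + r • z = 0 → s = 0 ∧ t = 0 ∧ r = 0) :
    LinearIndependent k ![x, y, z] := by
  rw [Fintype.linearIndependent_iff]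
  intro g hg
  simp only [Fin.sum_univ_three, Matrix.cons_val] at hg
  obtain ⟨h0, h1, h2⟩ := h _ _ _ hg
  intro i
  fin_cases i <;> assumption

theorem linearIndependent_quadruple {x y z w : V}
    (h : ∀ s t r q : k, s • x + t • y + r • z + q • w = 0 → s = 0 ∧ t = 0 ∧ r = 0 ∧ q = 0) :
    LinearIndependent k ![x, y, z, w] := by
  rw [Fintype.linearIndependent_iff]
  intro g hg
  simp only [Fin.sum_univ_four, Matrix.cons_val] at hg
  obtain ⟨h0, h1, h2, h3⟩ := h _ _ _ _ hg
  intro i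
  fin_cases i <;> assumption

theorem exists_ker_eq [FiniteDimensional k W] {U : Submodule k W}
    (hU : finrank k U + 1 = finrank k W) : ∃ ψ : W →ₗ[k] k, ψ ≠ 0 ∧ ker ψ = U := by
  obtain ⟨ψ, hψ, hle⟩ := Submodule.exists_le_ker_of_lt_top U
    (lt_top_iff_ne_top.2 fun h => by rw [h, finrank_top] at hU; omega)
  refine ⟨ψ, hψ, (Submodule.eq_of_le_of_finrank_le hle ?_).symm⟩
  have := Module.Dual.finrank_ker_add_one_of_ne_zero hψ
  omega

theorem ker_sup_eq_top {ψ : W →ₗ[k] k} {T : Submodule k W} {t : W} (ht : t ∈ T) (h : ψ t ≠ 0) :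
    ker ψ ⊔ T = ⊤ := by
  rw [eq_top_iff]
  intro w _
  rw [Submodule.mem_sup]
  exact ⟨w - (ψ w / ψ t) • t, by rw [mem_ker, map_sub, map_smul, smul_eq_mul, div_mul_cancel₀ _ h,
    sub_self], (ψ w / ψ t) • t, T.smul_mem _ ht, sub_add_cancel _ _⟩

theorem exists_coords_of_finrank_eq_two {U : Submodule k W} (hU : finrank k U = 2)
    {e f : W} (he : e ∈ U) (hf : f ∈ U) (hef : LinearIndependent k ![e, f]) {u : W} (hu : u ∈ U) :
    ∃ s t : k, u = s • e + t • f := by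
  have : FiniteDimensional k U := FiniteDimensional.of_finrank_pos (by omega)
  have h1 : Submodule.span k {e, f} = U := by
    refine Submodule.eq_of_le_of_finrank_le ?_ ?_
    · rw [Submodule.span_le]
      rintro _ (rfl | rfl) <;> assumption
    · have := finrank_span_eq_card hef
      rw [Matrix.range_cons_cons_empty, Fintype.card_fin] at this
      rw [this, hU]
  rw [← h1, Submodule.mem_span_pair] at hu
  obtain ⟨s, t, rfl⟩ := hu
  exact ⟨s, t, rfl⟩

theorem eq_span_singleton_of_lt {S U : Submodule k W} [FiniteDimensional k U]
    (hU : finrank k U = 2) (hSU : S < U) {e : W} (he : e ∈ S) (he0 : e ≠ 0) :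
    S = Submodule.span k {e} := by
  have hfin : FiniteDimensional k S := Submodule.finiteDimensional_of_le hSU.le
  have h1 := Submodule.finrank_lt_finrank_of_lt hSU
  refine (Submodule.eq_of_le_of_finrank_le ?_ ?_).symm
  · simpa using he
  · rw [finrank_span_singleton he0]
    omega

variable (B : V →ₗ[k] V →ₗ[k] W)

/-- The degree two part of `Cond1`; similarly for `Form2`, …, `Form8`. -/
def Form1 : Prop := ∃ x, B x x = 0 ∧ range (B x) = ⊤

def Form2 : Prop := ∃ x y, LinearIndependent k ![x, y] ∧ B x x = 0 ∧ finrank k (range (B x)) = 1 ∧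
  B y y ∈ range (B x) ∧ range (B x) ⊔ range (B y) = ⊤

def Form3 : Prop := ∃ x y, LinearIndependent k ![x, y] ∧ B x x = 0 ∧ B x y = 0 ∧
  B y y ∈ range (B x) ∧ range (B x) ⊔ range (B y) = ⊤

def Form4 : Prop := ∃ x y z, LinearIndependent k ![x, y, z] ∧ B x x = 0 ∧ B x z = 0 ∧
  B y y ∈ range (B x) ∧ range (B x) ⊔ Submodule.span k {B y z} = ⊤

def Form5 : Prop := ∃ x y z w, LinearIndependent k ![x, y, z, w] ∧ B x x = 0 ∧ B x w = 0 ∧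
  B y y ∈ range (B x) ∧ B y w ∈ range (B x) ∧ B w w - B y z ∈ range (B x) ∧
  range (B x) ⊔ Submodule.span k {B y z} = ⊤

def Form6 : Prop := ∃ x y z, LinearIndependent k ![x, y, z] ∧ B x x = 0 ∧ B x z = 0 ∧
  B y y ∈ range (B x) ∧ range (B x) ⊔ range (B y) = ⊤ ∧
  range (B z) = Submodule.span k {B z z} ∧
  (B x y ∈ range (B z) → ∃ w, LinearIndependent k ![x, y, z, w] ∧
    range (B x) = Submodule.span k {B x w, B z z}) ∧
  (B x y ∉ range (B z) → range (B x) = Submodule.span k {B x y, B z z})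

/-- The two rank conditions stand in for the indices i and j of the condition, which can be chosen
only once a basis is fixed. -/
def Form7 : Prop := ∃ x y z, LinearIndependent k ![x, y, z] ∧ B x x = 0 ∧
  B y y ∈ range (B x) ∧ B z z ∈ range (B x) ⊔ range (B y) ∧
  range (B x) ⊔ range (B y) ⊔ range (B z) = ⊤ ∧
  finrank k (range (B x)) = 1 ∧ finrank k ↥(range (B x) ⊔ range (B y)) = 2

def Form8 : Prop := ∃ x y, LinearIndependent k ![x, y] ∧ B x y = 0 ∧
  range (B x) = ⊤ ∧ range (B y) = ⊤

variable {B} [IsAlgClosed k] [FiniteDimensional k V] [FiniteDimensional k W]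

omit [IsAlgClosed k] [FiniteDimensional k V] [FiniteDimensional k W] in
theorem ne_zero_of_apply_ne_zero {x : V} (h : B x ≠ 0) : x ≠ 0 := by
  rintro rfl
  simp at h

/-- A null `x` exists because the radical has codimension at least 3 > dim W. If it has rank one,
take ψ with kernel its image: a vector `y` isotropic for ψ ∘ B and outside the radical has its
square in that image, and together with `x` fills W. -/
theorem Admissible.form1_or_form2 (hB : Admissible B) (hW : finrank k W = 2) :
    Form1 B ∨ Form2 B := by
  obtain ⟨x, hxx, hx⟩ := exists_null B (by have := hB.three_le_codim (by omega); omega)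
  by_cases ht : range (B x) = ⊤
  · exact .inl ⟨x, hxx, ht⟩
  have h1 := Submodule.one_le_finrank_iff.2 (mt range_eq_bot.1 hx)
  have h2 := Submodule.finrank_lt ht
  have hr : finrank k (range (B x)) = 1 := by omega
  obtain ⟨ψ, hψ, hker⟩ := exists_ker_eq (U := range (B x)) (by omega)
  obtain ⟨y, v, hyy, hyv⟩ := hB.exists_isotropic hψ
  refine .inr ⟨x, y, ?_, hxx, hr, by rwa [← hker], ?_⟩
  · rw [LinearIndependent.pair_iff]
    intro s t hst
    have ht : t = 0 := by
      have hxv : ψ (B x v) = 0 := by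
        have : B x v ∈ ker ψ := hker ▸ ⟨v, rfl⟩
        exact this
      have := congrArg (fun w => ψ (B w v)) hst
      simpa [hxv, hyv] using this
    subst ht
    simpa [ne_zero_of_apply_ne_zero hx] using hst
  · rw [← hker]
    exact ker_sup_eq_top ⟨v, rfl⟩ hyv

/-- Dividing W by the line `range (B x)` preserves admissibility and lowers the dimension to two.
Lifting the first normal form of the quotient gives `Form2`, lifting the second gives `Form7`. -/
theorem Admissible.form2_or_form7 (hB : Admissible B) (hW : finrank k W = 3) {x : V}
    (hxx : B x x = 0) (hr : finrank k (range (B x)) = 1) : Form2 B ∨ Form7 B := by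
  have hx0 : x ≠ 0 := by
    rintro rfl
    rw [map_zero, LinearMap.range_zero, finrank_bot] at hr
    omega
  set U := range (B x)
  have hB' := hB.compr₂ U.mkQ U.mkQ_surjective
  have hq := U.finrank_quotient_add_finrank
  have hrange : ∀ y, range (B.compr₂ U.mkQ y) = (range (B y)).map U.mkQ := fun y => by
    rw [← LinearMap.range_comp]; rfl
  rcases hB'.form1_or_form2 (by omega) with ⟨y, hyy, hy⟩ | ⟨y, z, -, hyy, hr', hzz, hyz⟩
  · rw [hrange, Submodule.map_mkQ_eq_top] at hy
    obtain ⟨v, hv⟩ : ∃ v, B y v ∉ U := by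
      by_contra! h
      have : range (B y) ≤ U := by rintro _ ⟨v, rfl⟩; exact h v
      rw [sup_eq_left.2 this] at hy
      rw [hy, finrank_top] at hr
      omega
    have hyyU : B y y ∈ U := by simpa using hyy
    refine .inl ⟨x, y, ?_, hxx, hr, hyyU, hy⟩
    rw [LinearIndependent.pair_iff]
    intro s t hst
    have ht : t = 0 := by
      by_contra ht
      refine hv ((U.smul_mem_iff ht).1 ?_)
      have := congr(B $hst v)
      simp only [map_add, map_smul, map_zero, LinearMap.add_apply, LinearMap.smul_apply,
        LinearMap.zero_apply] at this
      rw [eq_neg_of_add_eq_zero_right this]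
      exact U.neg_mem (U.smul_mem _ ⟨v, rfl⟩)
    subst ht
    simpa [hx0] using hst
  · rw [hrange] at hr' hzz
    rw [hrange, hrange, ← Submodule.map_sup, Submodule.map_mkQ_eq_top, ← sup_assoc] at hyz
    have hyU : ∃ v, B y v ∉ U := by
      by_contra! h
      have : range (B y) ≤ U := by rintro _ ⟨v, rfl⟩; exact h v
      have h0 : (range (B y)).map U.mkQ = ⊥ := by
        rw [eq_bot_iff, Submodule.map_le_iff_le_comap]
        simpa using this
      rw [h0, finrank_bot] at hr'
      omega
    obtain ⟨v, hv⟩ := hyU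
    have hlt : U < U ⊔ range (B y) := by
      refine lt_of_le_of_ne le_sup_left fun h => hv ?_
      rw [h]
      exact Submodule.mem_sup_right ⟨v, rfl⟩
    have h2 := Submodule.finrank_lt_finrank_of_lt hlt
    have hne : U ⊔ range (B y) ≠ ⊤ := fun h => by
      rw [← Submodule.map_mkQ_eq_top] at h
      rw [h, finrank_top] at hr'
      omega
    have h3 := Submodule.finrank_lt hne
    obtain ⟨v', hv'⟩ : ∃ v, B z v ∉ U ⊔ range (B y) := by
      by_contra! h
      have : range (B z) ≤ U ⊔ range (B y) := by rintro _ ⟨v, rfl⟩; exact h v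
      exact hne (by rwa [sup_eq_left.2 this] at hyz)
    have hyyU : B y y ∈ U := by simpa using hyy
    have hr2 : finrank k ↥(U ⊔ range (B y)) = 2 := by omega
    refine .inr ⟨x, y, z, ?_, hxx, hyyU, ?_, hyz, hr, hr2⟩
    · refine linearIndependent_triple fun s t r hstr => ?_
      have hr0 : r = 0 := by
        by_contra h0
        refine hv' ((Submodule.smul_mem_iff _ h0).1 ?_)
        have := congr(B $hstr v')
        simp only [map_add, map_smul, map_zero, LinearMap.add_apply, LinearMap.smul_apply,
          LinearMap.zero_apply] at this
        rw [eq_neg_of_add_eq_zero_right this]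
        exact Submodule.neg_mem _ (Submodule.add_mem_sup (Submodule.smul_mem _ _ ⟨v', rfl⟩)
          (Submodule.smul_mem _ _ ⟨v', rfl⟩))
      subst hr0
      have ht0 : t = 0 := by
        by_contra h0
        refine hv ((Submodule.smul_mem_iff _ h0).1 ?_)
        have := congr(B $hstr v)
        simp only [map_add, map_smul, map_zero, LinearMap.add_apply, LinearMap.smul_apply,
          LinearMap.zero_apply, zero_smul, add_zero] at this
        rw [eq_neg_of_add_eq_zero_right this]
        exact Submodule.neg_mem _ (Submodule.smul_mem _ _ ⟨v, rfl⟩)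
      subst ht0
      simpa [hx0] using hstr
    · rw [← Submodule.comap_map_mkQ]
      exact hzz

/-- A vector `x` of square zero and rank two whose annihilator is the radical of the form `ψ ∘ B`
that defines its image, and whose annihilator contains no vector of rank one. -/
structure IsPivot (B : V →ₗ[k] V →ₗ[k] W) (x : V) (ψ : W →ₗ[k] k) : Prop where
  sq : B x x = 0
  finrank_range : finrank k (range (B x)) = 2
  ker_eq : ker ψ = range (B x)
  annihilator : ∀ v, B x v = 0 ↔ ∀ w, ψ (B v w) = 0
  rank : ∀ z, B x z = 0 → B z ≠ 0 → finrank k (range (B z)) = 2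

/-- Let ψ cut out the image of `B x`. If some `z` with xz = 0 is outside the radical of ψ ∘ B, the
outcome is `Form3` when `z` is isotropic; otherwise an isotropic `y` gives `Form4` or `Form5`
according to whether ψ(yz) is nonzero. If there is no such `z`, the annihilator of `x`, of
codimension two, lies in a radical of codimension at least two, so they agree. -/
theorem Admissible.form345_or_annihilator (hB : Admissible B) (hW : finrank k W = 3) {x : V}
    (hxx : B x x = 0) (hr : finrank k (range (B x)) = 2) :
    Form3 B ∨ Form4 B ∨ Form5 B ∨ ∃ ψ : W →ₗ[k] k, ψ ≠ 0 ∧ ker ψ = range (B x) ∧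
      ∀ v, B x v = 0 ↔ ∀ w, ψ (B v w) = 0 := by
  have hx0 : x ≠ 0 := by
    rintro rfl
    rw [map_zero, LinearMap.range_zero, finrank_bot] at hr
    omega
  obtain ⟨ψ, hψ, hker⟩ := exists_ker_eq (U := range (B x)) (by omega)
  have hxw : ∀ w, ψ (B x w) = 0 := fun w => by
    have : B x w ∈ ker ψ := hker ▸ ⟨w, rfl⟩
    exact this
  have hwx : ∀ w, ψ (B w x) = 0 := fun w => by rw [hB.symm, hxw]
  by_cases hK : ∃ z v, B x z = 0 ∧ ψ (B z v) ≠ 0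
  · obtain ⟨z, v, hxz, hzv⟩ := hK
    by_cases hzz : ψ (B z z) = 0
    · refine .inl ⟨x, z, ?_, hxx, hxz, by rwa [← hker], ?_⟩
      · rw [LinearIndependent.pair_iff]
        intro s t hst
        have ht : t = 0 := by
          have := congrArg (fun w => ψ (B w v)) hst
          simpa [hxw, hzv] using this
        subst ht
        simpa [hx0] using hst
      · rw [← hker]
        exact ker_sup_eq_top ⟨v, rfl⟩ hzv
    · obtain ⟨y, w, hyy, hyw⟩ := hB.exists_isotropic hψ
      by_cases hyz : ψ (B y z) = 0
      -- The third vector is `w` rescaled so that its product with `y` has the same ψ-value as z²;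
      -- their difference then lies in ker ψ = `range (B x)`.
      · refine .inr (.inr (.inl ⟨x, y, (ψ (B z z) / ψ (B y w)) • w, z, ?_, hxx, hxz, by rwa [← hker],
          by rwa [← hker], ?_, ?_⟩))
        · refine linearIndependent_quadruple fun s t r q h => ?_
          have h1 := congrArg (fun w => ψ (B y w)) h
          have h2 := congrArg (fun w => ψ (B z w)) h
          have h3 := congrArg (fun v => ψ (B w v)) h
          simp only [map_add, map_smul, hwx, hyy, hyz, hB.symm z y, map_zero, smul_eq_mul,
            hB.symm w y] at h1 h2 h3
          have hr : r = 0 := by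
            simpa [hyw, hzz] using h1
          subst hr
          have hq : q = 0 := by
            simpa [hzz] using h2
          subst hq
          have ht : t = 0 := by
            simpa [hyw] using h3
          subst ht
          simpa [hx0] using h
        · rw [← hker]
          simp [hyw]
        · rw [← hker]
          refine ker_sup_eq_top (Submodule.mem_span_singleton_self _) ?_
          simpa [hyw] using hzz
      · refine .inr (.inl ⟨x, y, z, ?_, hxx, hxz, by rwa [← hker], ?_⟩)
        · refine linearIndependent_triple fun s t r h => ?_
          have h1 := congrArg (fun w => ψ (B y w)) h
          have h2 := congrArg (fun w => ψ (B z w)) h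
          simp only [map_add, map_smul, hwx, hyy, hB.symm z y, map_zero, smul_eq_mul] at h1 h2
          have hr : r = 0 := by simpa [hyz] using h1
          subst hr
          have ht : t = 0 := by simpa [hyz] using h2
          subst ht
          simpa [hx0] using h
        · rw [← hker]
          exact ker_sup_eq_top (Submodule.mem_span_singleton_self _) hyz
  · push Not at hK
    refine .inr (.inr (.inr ⟨ψ, hψ, hker, ?_⟩))
    have hle : ker (B x) ≤ ker (B.compr₂ ψ) := fun z hz => by
      ext v
      exact hK z v hz
    have h1 := finrank_range_add_finrank_ker (B x)
    have h2 := hB.finrank_ker_add_two_le hψ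
    have heq := Submodule.eq_of_le_of_finrank_le hle (by omega)
    intro v
    rw [← mem_ker, heq, mem_ker, LinearMap.ext_iff]
    rfl

-- The image of `B z` is the line through z², inside the plane `range (B x)`, so z² and any product
-- xw off this line span the plane. The vector `y` serves as `w` unless xy lies on the line, in
-- which case a new fourth vector is needed.
omit [FiniteDimensional k W] in
theorem Admissible.form6_of_rank_one (hB : Admissible B) {x z : V} {ψ : W →ₗ[k] k} (hψ : ψ ≠ 0)
    (hxx : B x x = 0) (hr : finrank k (range (B x)) = 2) (hker : ker ψ = range (B x))
    (hann : ∀ v, B x v = 0 ↔ ∀ w, ψ (B v w) = 0) (hxz : B x z = 0) (hzz : B z z ≠ 0)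
    (hrz : finrank k (range (B z)) = 1) : Form6 B := by
  have hx0 : x ≠ 0 := by
    rintro rfl
    rw [map_zero, LinearMap.range_zero, finrank_bot] at hr
    omega
  obtain ⟨y, v, hyy, hyv⟩ := hB.exists_isotropic hψ
  have hxy : B x y ≠ 0 := fun h => hyv ((hann y).1 h v)
  have hzx : B z x = 0 := by rw [hB.symm, hxz]
  have hzU : B z z ∈ range (B x) := hker ▸ (hann z).1 hxz z
  have hrange : range (B z) = Submodule.span k {B z z} := by
    refine (Submodule.eq_of_le_of_finrank_le ?_ ?_).symm
    · simp
    · rw [hrz, finrank_span_singleton hzz]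
  have hspan : ∀ w, B x w ∉ range (B z) → range (B x) = Submodule.span k {B x w, B z z} := by
    intro w hw
    have hli : LinearIndependent k ![B z z, B x w] := by
      rw [LinearIndependent.pair_iff' hzz]
      rintro a ha
      exact hw ⟨a • z, by simpa using ha⟩
    refine le_antisymm (fun u hu => ?_) ?_
    · obtain ⟨s, t, rfl⟩ := exists_coords_of_finrank_eq_two hr hzU ⟨w, rfl⟩ hli hu
      rw [Submodule.mem_span_pair]
      exact ⟨t, s, add_comm _ _⟩
    · rw [Submodule.span_le]
      rintro _ (rfl | rfl)
      · exact ⟨w, rfl⟩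
      · exact hzU
  refine ⟨x, y, z, ?_, hxx, hxz, by rwa [← hker], ?_, hrange, ?_, hspan y⟩
  · refine linearIndependent_triple fun s t r h => ?_
    have ht : t = 0 := by
      have := congrArg (B x) h
      simpa [hxx, hxz, hxy] using this
    subst ht
    have hr : r = 0 := by
      have := congrArg (B z) h
      simpa [hzx, hzz] using this
    subst hr
    simpa [hx0] using h
  · rw [← hker]
    exact ker_sup_eq_top ⟨v, rfl⟩ hyv
  · rintro ⟨c, hc⟩
    obtain ⟨w, hw⟩ : ∃ w, B x w ∉ range (B z) := by
      by_contra! h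
      have hle : range (B x) ≤ range (B z) := by rintro _ ⟨w, rfl⟩; exact h w
      have := Submodule.finrank_mono hle
      omega
    refine ⟨w, linearIndependent_quadruple fun s t r q h => ?_, hspan w hw⟩
    have h1 : t • B x y + q • B x w = 0 := by
      have := congrArg (B x) h
      simpa [hxx, hxz] using this
    have hq : q = 0 := by
      by_contra hq
      refine hw ((Submodule.smul_mem_iff _ hq).1 ?_)
      rw [eq_neg_of_add_eq_zero_right h1, ← hc]
      exact Submodule.neg_mem _ (Submodule.smul_mem _ _ ⟨c, rfl⟩)
    subst hq
    have ht : t = 0 := by simpa [hxy] using h1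
    subst ht
    have hr : r = 0 := by
      have := congrArg (B z) h
      simpa [hzx, hzz] using this
    subst hr
    simpa [hx0] using h

end Forms
-- Pivots: producing two surjective vectors with product zero, and the alternating case.
section Pivots
open Module LinearMap

variable {k : Type u} [Field k]
variable {V W : Type*} [AddCommGroup V] [Module k V] [AddCommGroup W] [Module k W]
variable {B : V →ₗ[k] V →ₗ[k] W}

namespace IsPivot

variable {x : V} {ψ : W →ₗ[k] k}

theorem apply_eq_zero (hP : IsPivot B x ψ) (w : V) : ψ (B x w) = 0 := by
  have : B x w ∈ ker ψ := hP.ker_eq ▸ ⟨w, rfl⟩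
  exact this

theorem mem_range (hP : IsPivot B x ψ) {z : V} (hz : B x z = 0) (w : V) : B z w ∈ range (B x) :=
  hP.ker_eq ▸ (hP.annihilator z).1 hz w

theorem finiteDimensional_range (hP : IsPivot B x ψ) : FiniteDimensional k (range (B x)) :=
  FiniteDimensional.of_finrank_pos (by rw [hP.finrank_range]; omega)

/-- Multiplication by `x` identifies V modulo the annihilator of `x` with the plane `range (B x)`,
so `p, q` are a basis modulo that annihilator. -/
theorem exists_coords (hP : IsPivot B x ψ) {p q : V} (h : LinearIndependent k ![B x p, B x q])
    (v : V) : ∃ s t : k, B x (v - s • p - t • q) = 0 := by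
  obtain ⟨s, t, hst⟩ := exists_coords_of_finrank_eq_two hP.finrank_range ⟨p, rfl⟩ ⟨q, rfl⟩ h
    ⟨v, rfl⟩
  exact ⟨s, t, by simp [hst]⟩

/-- Write K for the annihilator of `x`. If every (p + κ)K fell short of the plane xV, each would be
the line through xp, so both pK and KK would lie on that line. Then a translate of `z` by a multiple
of `x` would send all of V into the line, although non-radical elements of K have rank two. -/
theorem exists_range_le_map (hP : IsPivot B x ψ) (hB : Admissible B) {z : V} (hz : B x z = 0)
    (hzx : ∀ s : k, B (z - s • x) ≠ 0) {p q : V} (h : LinearIndependent k ![B x p, B x q]) :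
    ∃ κ, B x κ = 0 ∧ range (B x) ≤ (ker (B x)).map (B (p + κ)) := by
  by_contra! H
  have hfin := hP.finiteDimensional_range
  have hxp : B x p ≠ 0 := h.ne_zero 0
  have key : ∀ κ, B x κ = 0 → ∀ l, B x l = 0 → B (p + κ) l ∈ Submodule.span k {B x p} := by
    intro κ hκ l hl
    have hle : (ker (B x)).map (B (p + κ)) ≤ range (B x) := by
      rintro _ ⟨l, hl, rfl⟩
      rw [hB.symm]
      exact hP.mem_range hl _
    have hlt := lt_of_le_not_ge hle (H κ hκ)
    -- The line is the one through xp because `x` itself lies in its annihilator.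
    have hmem : B x p ∈ (ker (B x)).map (B (p + κ)) :=
      ⟨x, hP.sq, by simp [hB.symm _ x, hκ]⟩
    rw [← eq_span_singleton_of_lt hP.finrank_range hlt hmem hxp]
    exact ⟨l, hl, rfl⟩
  have key1 : ∀ l, B x l = 0 → B p l ∈ Submodule.span k {B x p} := fun l hl => by
    simpa using key 0 (by simp) l hl
  have key2 : ∀ κ, B x κ = 0 → ∀ l, B x l = 0 → B κ l ∈ Submodule.span k {B x p} :=
    fun κ hκ l hl => by
      have := Submodule.sub_mem _ (key κ hκ l hl) (key1 l hl)
      simpa using this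
  obtain ⟨v, hv⟩ := hP.mem_range hz q
  obtain ⟨s, t, hst⟩ := hP.exists_coords h v
  -- Here zq = xv with v = s p + t q modulo the annihilator, so subtracting t x from `z` removes the
  -- xq-component of zq.
  have hle : range (B (z - t • x)) ≤ Submodule.span k {B x p} := by
    have hz' : B x (z - t • x) = 0 := by simp [hz, hP.sq]
    rintro _ ⟨w, rfl⟩
    obtain ⟨s', t', hst'⟩ := hP.exists_coords h w
    have hq : B (z - t • x) q = s • B x p := by
      have : B x v = s • B x p + t • B x q := by
        rw [map_sub, map_sub, map_smul, map_smul] at hst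
        rw [← sub_eq_zero, ← hst]
        abel
      simp [← hv, this]
    have hw : w = s' • p + t' • q + (w - s' • p - t' • q) := by abel
    rw [hw, map_add, map_add, map_smul, map_smul, hq]
    refine Submodule.add_mem _ (Submodule.add_mem _ (Submodule.smul_mem _ _ ?_)
      (Submodule.smul_mem _ _ (Submodule.smul_mem _ _ (Submodule.mem_span_singleton_self _))))
      (key2 _ hz' _ hst')
    rw [hB.symm (z - t • x) p]
    exact key1 _ hz'
  have h1 := Submodule.finrank_mono hle
  rw [hP.rank _ (by simp [hz, hP.sq]) (hzx t), finrank_span_singleton hxp] at h1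
  omega

/-- Choose `q` orthogonal to `p` for ψ ∘ B and correct both by annihilators of `x` until each is
onto. Their product lies in ker ψ = xV, so it equals a xp + b xq; subtracting b x from the first and
a x from the second makes it zero and, as x kills its annihilator, keeps both onto. -/
theorem form8 (hP : IsPivot B x ψ) (hB : Admissible B) [FiniteDimensional k V] {z : V}
    (hz : B x z = 0)
    (hzx : ∀ s : k, B (z - s • x) ≠ 0) {p : V} (hp : ψ (B p p) ≠ 0) : Form8 B := by
  have hxp : B x p ≠ 0 := fun h => hp ((hP.annihilator p).1 h p)
  -- The kernel of ψ(p ·) has codimension one, so it is not contained in the annihilator of `x`, of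
  -- codimension two.
  obtain ⟨q, hpq, hxq⟩ : ∃ q, ψ (B p q) = 0 ∧ B x q ≠ 0 := by
    by_contra! h
    have h1 := finrank_range_add_finrank_ker (B x)
    have h2 : finrank k (ker (ψ ∘ₗ B p)) + 1 = finrank k V :=
      Module.Dual.finrank_ker_add_one_of_ne_zero (f := ψ ∘ₗ B p) fun h0 => hp congr($h0 p)
    have h3 : ker (ψ ∘ₗ B p) ≤ ker (B x) := fun q hq => h q hq
    have h4 := Submodule.finrank_mono h3
    rw [hP.finrank_range] at h1
    omega
  have hli : LinearIndependent k ![B x p, B x q] := by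
    rw [LinearIndependent.pair_iff]
    intro s t hst
    have hs : s = 0 := by
      have h1 := (hP.annihilator (s • p + t • q)).1 (by simpa using hst) p
      simpa [hB.symm q p, hpq, hp] using h1
    subst hs
    simpa [hxq] using hst
  obtain ⟨κ, hκ, hpκ⟩ := hP.exists_range_le_map hB hz hzx hli
  obtain ⟨κ', hκ', hqκ'⟩ := hP.exists_range_le_map hB hz hzx
    (LinearIndependent.pair_symm_iff.1 hli)
  have hψκ : ∀ {κ}, B x κ = 0 → ∀ w, ψ (B κ w) = 0 := fun h w => (hP.annihilator _).1 h w
  have hψκ' : ∀ {κ}, B x κ = 0 → ∀ w, ψ (B w κ) = 0 := fun h w => by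
    rw [hB.symm, hψκ h]
  have hψx : ∀ w, ψ (B w x) = 0 := hψκ' hP.sq
  have htop : ∀ {p κ : V} (b : k), B x p ≠ 0 → B x κ = 0 →
      range (B x) ≤ (ker (B x)).map (B (p + κ)) → range (B (p + κ - b • x)) = ⊤ := by
    intro p κ b hp hκ hle
    obtain ⟨w, hw⟩ : ∃ w, ψ (B p w) ≠ 0 := by
      by_contra! h
      exact hp ((hP.annihilator p).2 h)
    have hle' : range (B x) ≤ range (B (p + κ - b • x)) := by
      refine hle.trans ?_
      rintro _ ⟨l, hl, rfl⟩
      exact ⟨l, by simp [mem_ker.1 hl]⟩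
    have := ker_sup_eq_top (ψ := ψ) (T := range (B (p + κ - b • x))) ⟨w, rfl⟩
      (by simpa [hψκ hκ, hP.apply_eq_zero] using hw)
    rwa [hP.ker_eq, sup_eq_right.2 hle'] at this
  obtain ⟨v, hv⟩ : B (p + κ) (q + κ') ∈ range (B x) := by
    rw [← hP.ker_eq, mem_ker]
    simp [hpq, hψκ hκ, hψκ' hκ']
  obtain ⟨a, b, hab⟩ := hP.exists_coords hli v
  have hq' := htop a hxq hκ' hqκ'
  refine ⟨p + κ - b • x, q + κ' - a • x, ?_, ?_, htop b hxp hκ hpκ, hq'⟩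
  · rw [LinearIndependent.pair_iff]
    intro s t hst
    have hs : s = 0 := by
      have h1 := congrArg (fun w => ψ (B p w)) hst
      simpa [hpq, hψκ' hκ, hψκ' hκ', hψx, hp] using h1
    subst hs
    refine ⟨rfl, ?_⟩
    rw [zero_smul, zero_add, smul_eq_zero] at hst
    refine hst.resolve_right fun h0 => ?_
    rw [h0, map_zero, LinearMap.range_zero] at hq'
    have : B x p ∈ (⊤ : Submodule k W) := trivial
    rw [← hq', Submodule.mem_bot] at this
    exact hxp this
  · have h1 : B x v = a • B x p + b • B x q := by
      rw [map_sub, map_sub, map_smul, map_smul] at hab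
      rw [← sub_eq_zero, ← hab]
      abel
    have h2 : B (p + κ - b • x) x = B x p := by rw [hB.symm]; simp [hκ, hP.sq]
    have h3 : B x (q + κ') = B x q := by simp [hκ']
    rw [map_sub, map_smul, h2, map_sub, LinearMap.sub_apply, map_smul, LinearMap.smul_apply, h3,
      ← hv, h1]
    abel

/-- If z² = 0, then `z` is a pivot too, with the same image as `x`, and everything annihilating `x`
annihilates `z`. The pencil of `x` and `z` on a complement of the annihilator then has a singular
member, which annihilates `x` and is non-radical but has rank at most one. -/
theorem sq_ne_zero [IsAlgClosed k] [FiniteDimensional k V]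
    (hP : IsPivot B x ψ) {z : V} (hz : B x z = 0)
    (hzx : ∀ s : k, B (z - s • x) ≠ 0) (hpiv : B z z = 0 → ∃ ψ', IsPivot B z ψ') :
    B z z ≠ 0 := by
  intro hzz
  obtain ⟨ψ', hP'⟩ := hpiv hzz
  have hfin := hP.finiteDimensional_range
  have hrange : range (B z) = range (B x) := by
    refine Submodule.eq_of_le_of_finrank_le ?_ ?_
    · rintro _ ⟨w, rfl⟩
      exact hP.mem_range hz w
    · rw [hP.finrank_range, hP'.finrank_range]
  have hann : ∀ v, B x v = 0 → B z v = 0 := fun v hv => by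
    rw [hP'.annihilator]
    intro w
    rw [← mem_ker, hP'.ker_eq, hrange]
    exact hP.mem_range hv w
  obtain ⟨C, hC⟩ := Submodule.exists_isCompl (ker (B x))
  have hdim := Submodule.finrank_add_eq_of_isCompl hC
  have h1 := finrank_range_add_finrank_ker (B x)
  have h2 := hP.finrank_range
  have hC2 : finrank k C = finrank k (range (B x)) := by omega
  have : Nontrivial C := Module.nontrivial_of_finrank_pos (R := k) (by omega)
  obtain ⟨s, t, c, hst, hc0, hc⟩ := exists_pencil_not_injective
    ((B x).rangeRestrict ∘ₗ C.subtype)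
    ((B z).codRestrict (range (B x)) (hP.mem_range hz) ∘ₗ C.subtype) hC2
  have hc' : B (s • x + t • z) c = 0 := by
    simpa using congrArg Subtype.val hc
  have hcx : B x c ≠ 0 := fun h => hc0 <| by
    have : (c : V) ∈ ker (B x) ⊓ C := ⟨h, c.2⟩
    rw [hC.inf_eq_bot] at this
    simpa using this
  have hd : B (s • x + t • z) ≠ 0 := by
    intro h
    by_cases ht : t = 0
    · subst ht
      have hs : s ≠ 0 := by simpa using hst
      have := congr($h c)
      simp [hs, hcx] at this
    · refine hzx (-(s / t)) ?_
      have : s • x + t • z = t • (z - (-(s / t)) • x) := by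
        rw [smul_sub, smul_smul]
        field_simp
        rw [neg_smul]
        abel
      rw [this, map_smul, smul_eq_zero] at h
      exact h.resolve_left ht
  have h3 := hP.rank (s • x + t • z) (by simp [hP.sq, hz]) hd
  have hlt : ker (B x) < ker (B (s • x + t • z)) := by
    refine lt_of_le_of_ne (fun v hv => ?_) fun h => hcx ?_
    · simp [mem_ker.1 hv, hann v hv]
    · rw [← mem_ker, h]
      exact hc'
  have h4 := Submodule.finrank_lt_finrank_of_lt hlt
  have h5 := finrank_range_add_finrank_ker (B (s • x + t • z))
  omega

/-- Squares lie in both image planes. The planes are distinct because xy ≠ 0 says that `y` is not in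
the radical of ψ ∘ B, so they meet in the line through xy. -/
theorem sq_mem_span (hP : IsPivot B x ψ) (hB : Admissible B) (halt : ∀ v, ψ (B v v) = 0)
    {y : V} {ψ' : W →ₗ[k] k} (hP' : IsPivot B y ψ') (halt' : ∀ v, ψ' (B v v) = 0)
    (hxy : B x y ≠ 0) (v : V) : B v v ∈ Submodule.span k {B x y} := by
  have hfin := hP'.finiteDimensional_range
  have hlt : range (B x) ⊓ range (B y) < range (B y) := by
    refine lt_of_le_of_ne inf_le_right fun h => hxy ?_
    rw [hP.annihilator]
    intro w
    have : B y w ∈ range (B x) ⊓ range (B y) := by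
      rw [h]; exact ⟨w, rfl⟩
    rw [← hP.ker_eq] at this
    exact this.1
  rw [← eq_span_singleton_of_lt hP'.finrank_range hlt ⟨⟨y, rfl⟩, ⟨x, hB.symm _ _⟩⟩ hxy]
  exact ⟨hP.ker_eq ▸ halt v, hP'.ker_eq ▸ halt' v⟩

end IsPivot

variable [IsAlgClosed k] [FiniteDimensional k V]

/-- An alternating form ψ ∘ B ≠ 0 that comes from a symmetric map forces characteristic 2. Then
elements with proportional squares combine to one of square zero. Every null `y` with xy ≠ 0
confines all squares to the line through xy, and two null vectors giving different lines force z² =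
0, against `IsPivot.sq_ne_zero`. -/
theorem Admissible.false_of_alternating (hB : Admissible B)
    (h : ∀ x, B x x = 0 → B x ≠ 0 → ∃ ψ : W →ₗ[k] k, IsPivot B x ψ ∧ ∀ v, ψ (B v v) = 0)
    {x z : V} (hx : B x x = 0) (hx0 : B x ≠ 0) (hz : B x z = 0)
    (hzx : ∀ s : k, B (z - s • x) ≠ 0) : False := by
  obtain ⟨ψ, hP, halt⟩ := h x hx hx0
  have hzz : B z z ≠ 0 := hP.sq_ne_zero hz hzx fun hzz => by
    obtain ⟨ψ', hP', -⟩ := h z hzz (by simpa using hzx 0)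
    exact ⟨ψ', hP'⟩
  have hsq : ∀ v, B v v ∈ range (B x) := fun v => hP.ker_eq ▸ halt v
  have hfin := hP.finiteDimensional_range
  let b := finBasisOfFinrankEq k (range (B x)) hP.finrank_range
  obtain ⟨a₁, ha₁⟩ := (b 0).2
  obtain ⟨a₂, ha₂⟩ := (b 1).2
  have hli : LinearIndependent k ![B x a₁, B x a₂] := by
    have := b.linearIndependent.map' (range (B x)).subtype (Submodule.ker_subtype _)
    have he : ![B x a₁, B x a₂] = (range (B x)).subtype ∘ b := by
      ext i
      fin_cases i <;> simp [ha₁, ha₂]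
    rwa [he]
  have htwo : ∀ w : W, w + w = 0 := by
    have h2 : (2 : k) = 0 := by
      obtain ⟨w, hw⟩ : ∃ w, ψ (B a₁ w) ≠ 0 := by
        by_contra! h
        exact hli.ne_zero 0 ((hP.annihilator _).2 h)
      have := halt (a₁ + w)
      simp only [map_add, LinearMap.add_apply, halt, hB.symm w a₁, zero_add, add_zero] at this
      rw [← two_mul] at this
      exact (mul_eq_zero.1 this).resolve_right hw
    intro w
    rw [← two_smul k, h2, zero_smul]
  have hnull : ∀ {v w : V} {c : k}, B v v = c • B w w → ∃ r : k, B (v + r • w) (v + r • w) = 0 := by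
    intro v w c hc
    obtain ⟨r, hr⟩ := IsAlgClosed.exists_pow_nat_eq c (n := 2) two_pos
    refine ⟨r, ?_⟩
    have : B (v + r • w) (v + r • w) = (r ^ 2 • B w w + r ^ 2 • B w w) + (r • B v w + r • B v w) := by
      simp only [map_add, map_smul, LinearMap.add_apply, LinearMap.smul_apply, hc, hr, hB.symm w v]
      rw [← hr]
      module
    rw [this, htwo, htwo, add_zero]
  have hspan : ∀ {y : V}, B y y = 0 → B x y ≠ 0 → ∀ v, B v v ∈ Submodule.span k {B x y} := by
    intro y hy hxy v
    obtain ⟨ψ', hP', halt'⟩ := h y hy fun h0 => hxy (by rw [hB.symm, h0, LinearMap.zero_apply])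
    exact hP.sq_mem_span hB halt hP' halt' hxy v
  -- One null `p` already suffices: it makes q² proportional to z², so some `q + r z` is null; since
  -- xz = 0, it confines squares to the line through xq, and z² lies on two distinct lines.
  have hsecond : ∀ {p q : V}, LinearIndependent k ![B x p, B x q] → B p p = 0 → False := by
    intro p q hpq hp
    have hp1 := hspan hp (hpq.ne_zero 0)
    obtain ⟨c, hc⟩ := Submodule.mem_span_singleton.1 (hp1 z)
    obtain ⟨d, hd⟩ := Submodule.mem_span_singleton.1 (hp1 q)
    have hc0 : c ≠ 0 := by
      rintro rfl
      exact hzz (by simpa using hc.symm)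
    obtain ⟨r, hr⟩ := hnull (v := q) (w := z) (c := d / c) (by
      rw [← hc, ← hd, smul_smul, div_mul_cancel₀ _ hc0])
    have hxr : B x (q + r • z) = B x q := by simp [hz]
    have hq1 := hspan hr (by rw [hxr]; exact hpq.ne_zero 1) z
    rw [hxr] at hq1
    obtain ⟨e, he⟩ := Submodule.mem_span_singleton.1 hq1
    have := LinearIndependent.pair_iff.1 hpq c (-e) (by rw [hc, neg_smul, he]; simp)
    exact hc0 this.1
  -- The remaining task is to find the null `p`. Either a₁² is a multiple of z², or z² and a₁² span
  -- the plane containing a₂², and subtracting square roots of the coefficients works.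
  by_cases hdep : ∃ c : k, c • B z z = B a₁ a₁
  · obtain ⟨c, hc⟩ := hdep
    obtain ⟨r, hr⟩ := hnull hc.symm
    refine hsecond (p := a₁ + r • z) (q := a₂) ?_ hr
    simpa [hz] using hli
  · push Not at hdep
    have hli' : LinearIndependent k ![B z z, B a₁ a₁] := (LinearIndependent.pair_iff' hzz).2 hdep
    obtain ⟨c, d, hcd⟩ := exists_coords_of_finrank_eq_two hP.finrank_range (hsq z) (hsq a₁) hli'
      (hsq a₂)
    obtain ⟨r, hr⟩ := IsAlgClosed.exists_pow_nat_eq d (n := 2) two_pos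
    obtain ⟨r', hr'⟩ := hnull (v := a₂ + r • a₁) (w := z) (c := c) (by
      have : B (a₂ + r • a₁) (a₂ + r • a₁) = c • B z z + (r ^ 2 • B a₁ a₁ + r ^ 2 • B a₁ a₁) +
          (r • B a₁ a₂ + r • B a₁ a₂) := by
        simp only [map_add, map_smul, LinearMap.add_apply, LinearMap.smul_apply, hcd,
          hB.symm a₂ a₁]
        rw [← hr]
        module
      rw [this, htwo, htwo, add_zero, add_zero])
    refine hsecond (p := a₂ + r • a₁ + r' • z) (q := a₁) ?_ hr'
    have : B x (a₂ + r • a₁ + r' • z) = B x a₂ + r • B x a₁ := by simp [hz]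
    rw [this]
    rw [LinearIndependent.pair_iff] at hli ⊢
    intro s t hst
    have := hli (s * r + t) s (by rw [← hst]; module)
    obtain ⟨h1, rfl⟩ := this
    exact ⟨rfl, by simpa using h1⟩

theorem Admissible.form_of_four_le_codim [FiniteDimensional k W] (hB : Admissible B)
    (hW : finrank k W = 3) (h4 : finrank k (ker B) + 4 ≤ finrank k V) :
    Form1 B ∨ Form2 B ∨ Form3 B ∨ Form4 B ∨ Form5 B ∨ Form6 B ∨ Form7 B ∨ Form8 B := by
  by_contra! H
  obtain ⟨H1, H2, H3, H4, H5, H6, H7, H8⟩ := H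
  have hrank : ∀ x, B x x = 0 → B x ≠ 0 → finrank k (range (B x)) = 2 := by
    intro x hxx hx
    have h1 := Submodule.one_le_finrank_iff.2 (mt range_eq_bot.1 hx)
    have h2 := Submodule.finrank_lt fun ht => H1 ⟨x, hxx, ht⟩
    have h3 : finrank k (range (B x)) ≠ 1 := fun h => by
      rcases hB.form2_or_form7 hW hxx h with h | h
      · exact H2 h
      · exact H7 h
    omega
  have hpiv : ∀ x, B x x = 0 → B x ≠ 0 → ∃ ψ : W →ₗ[k] k, IsPivot B x ψ := by
    intro x hxx hx
    have hr := hrank x hxx hx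
    obtain ⟨ψ, hψ, hker, hann⟩ :=
      (((hB.form345_or_annihilator hW hxx hr).resolve_left H3).resolve_left H4).resolve_left H5
    refine ⟨ψ, hxx, hr, hker, hann, fun z hz hz0 => ?_⟩
    by_cases hzz : B z z = 0
    · exact hrank z hzz hz0
    have h1 := Submodule.one_le_finrank_iff.2 (mt range_eq_bot.1 hz0)
    have h2 : range (B z) ≤ range (B x) := by
      rintro _ ⟨w, rfl⟩
      exact hker ▸ (hann z).1 hz w
    have h3 := Submodule.finrank_mono h2
    have h4 : finrank k (range (B z)) ≠ 1 := fun h =>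
      H6 (hB.form6_of_rank_one hψ hxx hr hker hann hz hzz h)
    omega
  -- The annihilator of `x` has codimension two, the radical together with `x` codimension at least
  -- three; this is where codimension four is needed.
  have hker : ∀ x, B x x = 0 → B x ≠ 0 → ∃ z, B x z = 0 ∧ ∀ s : k, B (z - s • x) ≠ 0 := by
    intro x hxx hx
    by_contra! h
    have hle : ker (B x) ≤ ker B ⊔ Submodule.span k {x} := by
      intro z hz
      obtain ⟨s, hs⟩ := h z hz
      rw [Submodule.mem_sup]
      exact ⟨z - s • x, hs, s • x, Submodule.smul_mem _ _ (Submodule.mem_span_singleton_self x),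
        by simp⟩
    have h1 := Submodule.finrank_mono hle
    have h2 := Submodule.finrank_add_le_finrank_add_finrank (ker B) (Submodule.span k {x})
    have h3 := finrank_span_singleton (K := k) (ne_zero_of_apply_ne_zero hx)
    have h5 := finrank_range_add_finrank_ker (B x)
    rw [hrank x hxx hx] at h5
    omega
  obtain ⟨x, hxx, hx⟩ := exists_null B (by omega)
  obtain ⟨z, hz, hzx⟩ := hker x hxx hx
  refine hB.false_of_alternating (fun y hyy hy => ?_) hxx hx hz hzx
  obtain ⟨ψ, hP⟩ := hpiv y hyy hy
  refine ⟨ψ, hP, fun v => ?_⟩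
  by_contra hv
  obtain ⟨z', hz', hzx'⟩ := hker y hyy hy
  exact H8 (hP.form8 hB hz' hzx' hv)

end Pivots
-- Completing independent vectors to an indexed basis.
section Extension
open Module

theorem exists_basis_extending {k V : Type*} [Field k] [AddCommGroup V] [Module k V]
    [FiniteDimensional k V] {m : ℕ} {x : Fin m → V} (hx : LinearIndependent k x) :
    ∃ (e : ℕ) (b : Basis (Fin e) k V) (h : m ≤ e), ∀ i : Fin m, b (Fin.castLE h i) = x i := by
  have hfin : Finite (Fin m ⊕ ↑(Basis.sumExtendIndex hx)) :=
    Module.Finite.finite_basis (Basis.sumExtend hx)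
  have : Finite ↑(Basis.sumExtendIndex hx) := Finite.sum_right (Fin m)
  have := Fintype.ofFinite ↑(Basis.sumExtendIndex hx)
  refine ⟨_, (Basis.sumExtend hx).reindex (((Equiv.refl _).sumCongr (Fintype.equivFin _)).trans
    finSumFinEquiv), Nat.le_add_right _ _, fun i => ?_⟩
  have : Fin.castLE (Nat.le_add_right m (Fintype.card ↑(Basis.sumExtendIndex hx))) i =
    finSumFinEquiv (Sum.inl i) := rfl
  rw [Basis.reindex_apply, this]
  simp only [finSumFinEquiv_apply_left, Basis.sumExtend, Equiv.symm_trans_apply,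
    finSumFinEquiv_symm_apply_castAdd, Equiv.sumCongr_symm, Equiv.sumCongr_apply, Sum.map_inl,
    Basis.reindex_apply, Basis.extend_apply_self]
  rfl

end Extension

/-! ### Ideals generated by quadratic forms and the multiplication of linear forms. -/

section Degree2
open Module LinearMap

variable {k : Type u} {R : Type v} [Field k] [CommRing R] [Algebra k R]
variable (𝒜 : ℕ → Submodule k R)

/-- The ideal generated by a space of quadratic forms. -/
def quadIdeal (U : Submodule k (𝒜 2)) : Ideal R := Ideal.span (Subtype.val '' (U : Set (𝒜 2)))

variable {𝒜}

theorem coe_mem_quadIdeal {U : Submodule k (𝒜 2)} {w : 𝒜 2} (hw : w ∈ U) :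
    (w : R) ∈ quadIdeal 𝒜 U := Ideal.subset_span ⟨w, hw, rfl⟩

theorem quadIdeal_le {U : Submodule k (𝒜 2)} {J : Ideal R} :
    quadIdeal 𝒜 U ≤ J ↔ ∀ w ∈ U, (w : R) ∈ J := by
  rw [quadIdeal, Ideal.span_le]
  simp [Set.subset_def]

theorem quadIdeal_sup (U U' : Submodule k (𝒜 2)) :
    quadIdeal 𝒜 (U ⊔ U') = quadIdeal 𝒜 U + quadIdeal 𝒜 U' := by
  apply le_antisymm
  · rw [quadIdeal_le]
    intro w hw
    obtain ⟨a, ha, b, hb, rfl⟩ := Submodule.mem_sup.1 hw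
    exact Submodule.add_mem_sup (coe_mem_quadIdeal ha) (coe_mem_quadIdeal hb)
  · refine sup_le ?_ ?_ <;> rw [quadIdeal_le]
    · exact fun w hw => coe_mem_quadIdeal (Submodule.mem_sup_left hw)
    · exact fun w hw => coe_mem_quadIdeal (Submodule.mem_sup_right hw)

theorem quadIdeal_span (S : Set (𝒜 2)) :
    quadIdeal 𝒜 (Submodule.span k S) = Ideal.span (Subtype.val '' S) := by
  apply le_antisymm
  · rw [quadIdeal_le]
    intro w hw
    induction hw using Submodule.span_induction with
    | mem w hw => exact Ideal.subset_span ⟨w, hw, rfl⟩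
    | zero => simp
    | add a b _ _ ha hb => exact add_mem ha hb
    | smul c a _ ha =>
      rw [Submodule.coe_smul]
      exact Submodule.smul_of_tower_mem _ c ha
  · exact Ideal.span_mono (Set.image_mono Submodule.subset_span)

variable (𝒜) [GradedAlgebra 𝒜]

/-- The multiplication of linear forms. -/
def linMul : 𝒜 1 →ₗ[k] 𝒜 1 →ₗ[k] 𝒜 2 :=
  LinearMap.mk₂ k (fun x y => ⟨x * y, SetLike.mul_mem_graded x.2 y.2⟩)
    (fun _ _ _ => Subtype.ext (add_mul _ _ _)) (fun _ _ _ => Subtype.ext (smul_mul_assoc _ _ _))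
    (fun _ _ _ => Subtype.ext (mul_add _ _ _)) (fun _ _ _ => Subtype.ext (mul_smul_comm _ _ _))

@[simp]
theorem coe_linMul (x y : 𝒜 1) : (linMul 𝒜 x y : R) = x * y := rfl

variable {𝒜}

theorem linMul_symm (x y : 𝒜 1) : linMul 𝒜 x y = linMul 𝒜 y x := Subtype.ext (mul_comm _ _)

namespace IsStandardGraded

variable (h : IsStandardGraded 𝒜)
include h

theorem exists_algebraMap_eq {a : R} (ha : a ∈ 𝒜 0) : ∃ c : k, algebraMap k R c = a := by
  rw [h.zero_eq] at ha
  exact Submodule.mem_one.1 ha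

/-- Since R₀ = k, an ideal generated in degree two gains nothing new in degree two. This lets ideal
membership be tested by linear algebra in R₂. -/
theorem coe_mem_quadIdeal_iff {U : Submodule k (𝒜 2)} {w : 𝒜 2} :
    (w : R) ∈ quadIdeal 𝒜 U ↔ w ∈ U := by
  refine ⟨fun hw => ?_, coe_mem_quadIdeal⟩
  -- The extra factor `a` makes the claim stable under multiplication, as the induction over the
  -- ideal requires.
  have key : ∀ r ∈ quadIdeal 𝒜 U, ∀ a, DirectSum.decompose 𝒜 (a * r) 2 ∈ U := by
    intro r hr
    induction hr using Submodule.span_induction with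
    | mem w hw =>
      obtain ⟨w, hw, rfl⟩ := hw
      intro a
      obtain ⟨c, hc⟩ := h.exists_algebraMap_eq (DirectSum.decompose 𝒜 a 0).2
      have : DirectSum.decompose 𝒜 (a * w) 2 = c • w := by
        apply Subtype.ext
        have := DirectSum.coe_decompose_mul_add_of_right_mem 𝒜 (i := 0) (a := a) w.2
        rw [zero_add] at this
        rw [this, ← hc, Submodule.coe_smul, Algebra.smul_def]
      rw [this]
      exact U.smul_mem c hw
    | zero => simp
    | add a b _ _ ha hb =>
      intro c
      rw [mul_add, DirectSum.decompose_add]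
      exact add_mem (ha c) (hb c)
    | smul b r hr ih =>
      intro a
      rw [smul_eq_mul, ← mul_assoc]
      exact ih _
  have := key _ hw 1
  rwa [one_mul, DirectSum.decompose_coe, DirectSum.of_eq_same] at this

theorem maxIdeal_eq_span : maxIdeal 𝒜 = Ideal.span (𝒜 1 : Set R) := by
  have hle : Ideal.span (𝒜 1 : Set R) ≤ maxIdeal 𝒜 := by
    rw [Ideal.span_le]
    intro x hx
    exact HomogeneousIdeal.mem_irrelevant_of_mem 𝒜 one_pos hx
  refine le_antisymm (fun r hr => ?_) hle
  have key : ∀ r : R, ∃ c : k, r - algebraMap k R c ∈ Ideal.span (𝒜 1 : Set R) := by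
    intro r
    have hr : r ∈ Algebra.adjoin k (𝒜 1 : Set R) := h.generated ▸ trivial
    induction hr using Algebra.adjoin_induction with
    | mem x hx => exact ⟨0, by simpa using Ideal.subset_span hx⟩
    | algebraMap c => exact ⟨c, by simp⟩
    | add a b _ _ ha hb =>
      obtain ⟨c, hc⟩ := ha
      obtain ⟨d, hd⟩ := hb
      refine ⟨c + d, ?_⟩
      have : a + b - algebraMap k R (c + d) = (a - algebraMap k R c) + (b - algebraMap k R d) := by
        rw [map_add]; ring
      rw [this]
      exact add_mem hc hd
    | mul a b _ _ ha hb =>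
      obtain ⟨c, hc⟩ := ha
      obtain ⟨d, hd⟩ := hb
      refine ⟨c * d, ?_⟩
      have : a * b - algebraMap k R (c * d) =
          b * (a - algebraMap k R c) + algebraMap k R c * (b - algebraMap k R d) := by
        rw [map_mul]; ring
      rw [this]
      exact add_mem (Ideal.mul_mem_left _ _ hc) (Ideal.mul_mem_left _ _ hd)
  obtain ⟨c, hc⟩ := key r
  have h1 : algebraMap k R c ∈ maxIdeal 𝒜 := by
    have := sub_mem hr (hle hc)
    simpa using this
  have h2 : (DirectSum.decompose 𝒜 (algebraMap k R c) 0 : R) = 0 := h1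
  have h3 : algebraMap k R c ∈ 𝒜 0 := by
    rw [h.zero_eq]
    exact Submodule.algebraMap_mem c
  rw [DirectSum.decompose_of_mem_same 𝒜 h3] at h2
  simpa [h2] using hc

theorem two_le_mul : 𝒜 2 ≤ 𝒜 1 * 𝒜 1 := by
  have key : ∀ r : R, (DirectSum.decompose 𝒜 r 2 : R) ∈ 𝒜 1 * 𝒜 1 := by
    intro r
    have hr : r ∈ Algebra.adjoin k (𝒜 1 : Set R) := h.generated ▸ trivial
    induction hr using Algebra.adjoin_induction with
    | mem x hx =>
      rw [DirectSum.decompose_of_mem_ne 𝒜 hx (by decide)]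
      exact zero_mem _
    | algebraMap c =>
      have h3 : algebraMap k R c ∈ 𝒜 0 := by
        rw [h.zero_eq]
        exact Submodule.algebraMap_mem c
      rw [DirectSum.decompose_of_mem_ne 𝒜 h3 (by decide)]
      exact zero_mem _
    | add a b _ _ ha hb =>
      rw [DirectSum.decompose_add]
      exact add_mem ha hb
    | mul a b _ _ ha hb =>
      rw [DirectSum.decompose_mul, DirectSum.coe_mul_apply_eq_sum_antidiagonal,
        Finset.Nat.antidiagonal_eq_map]
      simp only [Finset.sum_map, Finset.sum_range_succ, Finset.sum_range_zero, zero_add]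
      obtain ⟨c, hc⟩ := h.exists_algebraMap_eq (DirectSum.decompose 𝒜 a 0).2
      obtain ⟨d, hd⟩ := h.exists_algebraMap_eq (DirectSum.decompose 𝒜 b 0).2
      refine add_mem (add_mem ?_ ?_) ?_
      · change (DirectSum.decompose 𝒜 a 0 : R) * (DirectSum.decompose 𝒜 b 2 : R) ∈ _
        rw [← hc, ← Algebra.smul_def]
        exact Submodule.smul_mem _ c hb
      · exact Submodule.mul_mem_mul (Subtype.prop _) (Subtype.prop _)
      · change (DirectSum.decompose 𝒜 a 2 : R) * (DirectSum.decompose 𝒜 b 0 : R) ∈ _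
        rw [← hd, mul_comm _ (algebraMap k R d), ← Algebra.smul_def]
        exact Submodule.smul_mem _ d ha
  intro w hw
  have := key w
  rwa [DirectSum.decompose_of_mem_same 𝒜 hw] at this

theorem maxIdeal_sq : maxIdeal 𝒜 ^ 2 = quadIdeal 𝒜 ⊤ := by
  rw [h.maxIdeal_eq_span, pow_two]
  apply le_antisymm
  · rw [Ideal.span_mul_span', Ideal.span_le]
    rintro _ ⟨x, hx, y, hy, rfl⟩
    exact coe_mem_quadIdeal (w := linMul 𝒜 ⟨x, hx⟩ ⟨y, hy⟩) trivial
  · rw [quadIdeal_le]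
    intro w _
    suffices ∀ r ∈ 𝒜 1 * 𝒜 1, r ∈ Ideal.span (𝒜 1 : Set R) * Ideal.span (𝒜 1 : Set R) from
      this _ (h.two_le_mul w.2)
    intro r hr
    induction hr using Submodule.mul_induction_on' with
    | mem_mul_mem x hx y hy => exact Ideal.mul_mem_mul (Ideal.subset_span hx) (Ideal.subset_span hy)
    | add a _ b _ ha hb => exact add_mem ha hb

theorem span_mul_maxIdeal (x : 𝒜 1) :
    Ideal.span {(x : R)} * maxIdeal 𝒜 = quadIdeal 𝒜 (range (linMul 𝒜 x)) := by
  rw [h.maxIdeal_eq_span, Ideal.span_mul_span', quadIdeal]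
  congr 1
  ext r
  constructor
  · rintro ⟨_, rfl, y, hy, rfl⟩
    exact ⟨linMul 𝒜 x ⟨y, hy⟩, ⟨_, rfl⟩, rfl⟩
  · rintro ⟨_, ⟨y, rfl⟩, rfl⟩
    exact ⟨x, rfl, y, y.2, rfl⟩

theorem eq_zero_of_forall (ψ : 𝒜 2 →ₗ[k] k) (hψ : ∀ x y, ψ (linMul 𝒜 x y) = 0) : ψ = 0 := by
  have hle : 𝒜 1 * 𝒜 1 ≤ (ker ψ).map (𝒜 2).subtype := by
    rw [Submodule.mul_le]
    intro x hx y hy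
    exact ⟨linMul 𝒜 ⟨x, hx⟩ ⟨y, hy⟩, hψ _ _, rfl⟩
  ext w
  obtain ⟨w', hw', hww⟩ := hle (h.two_le_mul w.2)
  rw [← Subtype.ext hww]
  exact hw'

end IsStandardGraded
end Degree2
-- From normal forms of the bilinear map to the conditions on the maximal ideal.
section Translation
open Module LinearMap

variable {k : Type u} {R : Type v} [Field k] [CommRing R] [Algebra k R]
variable {𝒜 : ℕ → Submodule k R} [GradedAlgebra 𝒜]

namespace IsStandardGraded

variable (h : IsStandardGraded 𝒜)
include h

theorem sq_eq_of_range_eq_top {x : 𝒜 1} (hx : range (linMul 𝒜 x) = ⊤) :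
    maxIdeal 𝒜 ^ 2 = Ideal.span {(x : R)} * maxIdeal 𝒜 := by
  rw [h.span_mul_maxIdeal, hx, h.maxIdeal_sq]

theorem sq_eq_of_sup_eq_top {x y : 𝒜 1}
    (hx : range (linMul 𝒜 x) ⊔ range (linMul 𝒜 y) = ⊤) :
    maxIdeal 𝒜 ^ 2 = Ideal.span {(x : R)} * maxIdeal 𝒜 + Ideal.span {(y : R)} * maxIdeal 𝒜 := by
  rw [h.span_mul_maxIdeal, h.span_mul_maxIdeal, ← quadIdeal_sup, hx, h.maxIdeal_sq]

theorem mul_mem_iff {x y z : 𝒜 1} : (y * z : R) ∈ Ideal.span {(x : R)} * maxIdeal 𝒜 ↔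
    linMul 𝒜 y z ∈ range (linMul 𝒜 x) := by
  rw [h.span_mul_maxIdeal, ← coe_linMul, h.coe_mem_quadIdeal_iff]

theorem sq_eq_of_sup_span_eq_top {x y z : 𝒜 1}
    (hx : range (linMul 𝒜 x) ⊔ Submodule.span k {linMul 𝒜 y z} = ⊤) :
    maxIdeal 𝒜 ^ 2 = Ideal.span {(x : R)} * maxIdeal 𝒜 + Ideal.span {(y * z : R)} := by
  have h1 : Ideal.span {(y * z : R)} = quadIdeal 𝒜 (Submodule.span k {linMul 𝒜 y z}) := by
    rw [quadIdeal_span, Set.image_singleton, coe_linMul]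
  rw [h.span_mul_maxIdeal, h1, ← quadIdeal_sup, hx, h.maxIdeal_sq]

theorem span_mul_eq_singleton {x y z : 𝒜 1}
    (hx : range (linMul 𝒜 x) = Submodule.span k {linMul 𝒜 y z}) :
    Ideal.span {(x : R)} * maxIdeal 𝒜 = Ideal.span {(y * z : R)} := by
  rw [h.span_mul_maxIdeal, hx, quadIdeal_span, Set.image_singleton, coe_linMul]

theorem span_mul_eq_pair {x y z y' z' : 𝒜 1}
    (hx : range (linMul 𝒜 x) = Submodule.span k {linMul 𝒜 y z, linMul 𝒜 y' z'}) :
    Ideal.span {(x : R)} * maxIdeal 𝒜 = Ideal.span {(y * z : R), (y' * z' : R)} := by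
  rw [h.span_mul_maxIdeal, hx, quadIdeal_span, Set.image_pair, coe_linMul, coe_linMul]

theorem span_pair_mul_maxIdeal (x y : 𝒜 1) :
    Ideal.span {(x : R), (y : R)} * maxIdeal 𝒜 =
      quadIdeal 𝒜 (range (linMul 𝒜 x) ⊔ range (linMul 𝒜 y)) := by
  rw [Ideal.span_insert, Ideal.sup_mul, h.span_mul_maxIdeal, h.span_mul_maxIdeal, quadIdeal_sup]
  rfl

omit h in
theorem mul_eq_zero_of {x y : 𝒜 1} (hxy : linMul 𝒜 x y = 0) : (x * y : R) = 0 := by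
  rw [← coe_linMul, hxy, Submodule.coe_zero]

omit h in
theorem range_eq_span_of_finrank_one {x z : 𝒜 1}
    (hr : finrank k (range (linMul 𝒜 x)) = 1) (hz : linMul 𝒜 x z ≠ 0) :
    range (linMul 𝒜 x) = Submodule.span k {linMul 𝒜 x z} := by
  have : FiniteDimensional k (range (linMul 𝒜 x)) := FiniteDimensional.of_finrank_pos (by omega)
  refine (Submodule.eq_of_le_of_finrank_le ?_ ?_).symm
  · simp
  · rw [hr, finrank_span_singleton hz]

theorem upToChange_cond1 [Nontrivial (𝒜 2)] (hf : Form1 (linMul 𝒜)) :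
    UpToChange 𝒜 (Cond1 (maxIdeal 𝒜)) := by
  have := h.finite_one
  obtain ⟨x, hxx, hx⟩ := hf
  have hx0 : x ≠ 0 := by
    rintro rfl
    rw [map_zero, LinearMap.range_zero] at hx
    exact bot_ne_top hx
  obtain ⟨e, b, he, hb⟩ := exists_basis_extending
    (LinearIndependent.of_subsingleton (R := k) (v := ![x]) 0 hx0)
  have hb0 : b ⟨0, he⟩ = x := hb 0
  refine ⟨e, b, he, ?_⟩
  simp only [hb0, pow_two (x : R)]
  exact ⟨h.sq_eq_of_range_eq_top hx, mul_eq_zero_of hxx⟩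

theorem upToChange_cond2 (hf : Form2 (linMul 𝒜)) : UpToChange 𝒜 (Cond2 (maxIdeal 𝒜)) := by
  have := h.finite_one
  obtain ⟨x, y, hli, hxx, hr, hyy, hxy⟩ := hf
  by_cases hxy0 : linMul 𝒜 x y = 0
  · obtain ⟨z, hz⟩ : ∃ z, linMul 𝒜 x z ≠ 0 := by
      by_contra! h0
      have : range (linMul 𝒜 x) = ⊥ := by
        rw [range_eq_bot]
        exact LinearMap.ext h0
      rw [this, finrank_bot] at hr
      omega
    have hli3 : LinearIndependent k ![x, y, z] := by
      refine linearIndependent_triple fun s t r h0 => ?_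
      have hr : r = 0 := by
        have := congrArg (linMul 𝒜 x) h0
        simpa [hxx, hxy0, hz] using this
      subst hr
      have := LinearIndependent.pair_iff.1 hli s t (by simpa using h0)
      exact ⟨this.1, this.2, rfl⟩
    obtain ⟨e, b, he, hb⟩ := exists_basis_extending hli3
    have hb0 : b ⟨0, by omega⟩ = x := hb 0
    have hb1 : b ⟨1, by omega⟩ = y := hb 1
    have hb2 : b ⟨2, by omega⟩ = z := hb 2
    refine ⟨e, b, by omega, by omega, ?_⟩
    simp only [hb0, hb1, pow_two (x : R), pow_two (y : R)]
    refine ⟨h.sq_eq_of_sup_eq_top hxy, mul_eq_zero_of hxx, h.mul_mem_iff.2 hyy,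
      fun h0 => absurd (mul_eq_zero_of hxy0) h0, fun _ => ⟨he, ?_⟩⟩
    rw [hb2]
    exact h.span_mul_eq_singleton (range_eq_span_of_finrank_one hr hz)
  · obtain ⟨e, b, he, hb⟩ := exists_basis_extending hli
    have hb0 : b ⟨0, by omega⟩ = x := hb 0
    have hb1 : b ⟨1, by omega⟩ = y := hb 1
    refine ⟨e, b, by omega, by omega, ?_⟩
    simp only [hb0, hb1, pow_two (x : R), pow_two (y : R)]
    exact ⟨h.sq_eq_of_sup_eq_top hxy, mul_eq_zero_of hxx, h.mul_mem_iff.2 hyy,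
      fun _ => h.span_mul_eq_singleton (range_eq_span_of_finrank_one hr hxy0),
      fun h0 => absurd (Subtype.ext h0) hxy0⟩

theorem upToChange_cond3 (hf : Form3 (linMul 𝒜)) : UpToChange 𝒜 (Cond3 (maxIdeal 𝒜)) := by
  have := h.finite_one
  obtain ⟨x, y, hli, hxx, hxy, hyy, htop⟩ := hf
  obtain ⟨e, b, he, hb⟩ := exists_basis_extending hli
  have hb0 : b ⟨0, by omega⟩ = x := hb 0
  have hb1 : b ⟨1, by omega⟩ = y := hb 1
  refine ⟨e, b, by omega, by omega, ?_⟩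
  simp only [hb0, hb1, pow_two (x : R), pow_two (y : R)]
  exact ⟨h.sq_eq_of_sup_eq_top htop, mul_eq_zero_of hxx, mul_eq_zero_of hxy, h.mul_mem_iff.2 hyy⟩

theorem upToChange_cond4 (hf : Form4 (linMul 𝒜)) : UpToChange 𝒜 (Cond4 (maxIdeal 𝒜)) := by
  have := h.finite_one
  obtain ⟨x, y, z, hli, hxx, hxz, hyy, htop⟩ := hf
  obtain ⟨e, b, he, hb⟩ := exists_basis_extending hli
  have hb0 : b ⟨0, by omega⟩ = x := hb 0
  have hb1 : b ⟨1, by omega⟩ = y := hb 1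
  have hb2 : b ⟨2, by omega⟩ = z := hb 2
  refine ⟨e, b, by omega, by omega, by omega, ?_⟩
  simp only [hb0, hb1, hb2, pow_two (x : R), pow_two (y : R)]
  exact ⟨h.sq_eq_of_sup_span_eq_top htop, mul_eq_zero_of hxx, mul_eq_zero_of hxz,
    h.mul_mem_iff.2 hyy⟩

theorem upToChange_cond5 (hf : Form5 (linMul 𝒜)) : UpToChange 𝒜 (Cond5 (maxIdeal 𝒜)) := by
  have := h.finite_one
  obtain ⟨x, y, z, w, hli, hxx, hxw, hyy, hyw, hww, htop⟩ := hf
  obtain ⟨e, b, he, hb⟩ := exists_basis_extending hli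
  have hb0 : b ⟨0, by omega⟩ = x := hb 0
  have hb1 : b ⟨1, by omega⟩ = y := hb 1
  have hb2 : b ⟨2, by omega⟩ = z := hb 2
  have hb3 : b ⟨3, by omega⟩ = w := hb 3
  refine ⟨e, b, by omega, by omega, by omega, by omega, ?_⟩
  simp only [hb0, hb1, hb2, hb3, pow_two (x : R), pow_two (y : R), pow_two (w : R)]
  refine ⟨h.sq_eq_of_sup_span_eq_top htop, mul_eq_zero_of hxx, mul_eq_zero_of hxw,
    h.mul_mem_iff.2 hyy, h.mul_mem_iff.2 hyw, ?_⟩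
  rw [h.span_mul_maxIdeal]
  exact coe_mem_quadIdeal hww

theorem upToChange_cond6 (hf : Form6 (linMul 𝒜)) : UpToChange 𝒜 (Cond6 (maxIdeal 𝒜)) := by
  have := h.finite_one
  obtain ⟨x, y, z, hli, hxx, hxz, hyy, htop, hz, h1, h2⟩ := hf
  by_cases hxy : linMul 𝒜 x y ∈ range (linMul 𝒜 z)
  · obtain ⟨w, hli', hw⟩ := h1 hxy
    obtain ⟨e, b, he, hb⟩ := exists_basis_extending hli'
    have hb0 : b ⟨0, by omega⟩ = x := hb 0
    have hb1 : b ⟨1, by omega⟩ = y := hb 1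
    have hb2 : b ⟨2, by omega⟩ = z := hb 2
    have hb3 : b ⟨3, by omega⟩ = w := hb 3
    refine ⟨e, b, by omega, by omega, by omega, ?_⟩
    simp only [hb0, hb1, hb2, hb3, pow_two (x : R), pow_two (y : R), pow_two (z : R)]
    exact ⟨h.sq_eq_of_sup_eq_top htop, mul_eq_zero_of hxx, mul_eq_zero_of hxz, h.mul_mem_iff.2 hyy,
      h.span_mul_eq_singleton hz, fun _ => ⟨he, h.span_mul_eq_pair hw⟩,
      fun h0 => absurd (h.mul_mem_iff.2 hxy) h0⟩
  · obtain ⟨e, b, he, hb⟩ := exists_basis_extending hli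
    have hb0 : b ⟨0, by omega⟩ = x := hb 0
    have hb1 : b ⟨1, by omega⟩ = y := hb 1
    have hb2 : b ⟨2, by omega⟩ = z := hb 2
    refine ⟨e, b, by omega, by omega, by omega, ?_⟩
    simp only [hb0, hb1, hb2, pow_two (x : R), pow_two (y : R), pow_two (z : R)]
    exact ⟨h.sq_eq_of_sup_eq_top htop, mul_eq_zero_of hxx, mul_eq_zero_of hxz, h.mul_mem_iff.2 hyy,
      h.span_mul_eq_singleton hz, fun h0 => absurd (h.mul_mem_iff.1 h0) hxy,
      fun _ => h.span_mul_eq_pair (h2 hxy)⟩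

theorem upToChange_cond7 (hf : Form7 (linMul 𝒜)) : UpToChange 𝒜 (Cond7 (maxIdeal 𝒜)) := by
  have := h.finite_one
  obtain ⟨x, y, z, hli, hxx, hyy, hzz, htop, hr, hr2⟩ := hf
  obtain ⟨e, b, he, hb⟩ := exists_basis_extending hli
  have hb0 : b ⟨0, by omega⟩ = x := hb 0
  have hb1 : b ⟨1, by omega⟩ = y := hb 1
  have hb2 : b ⟨2, by omega⟩ = z := hb 2
  have hrange : ∀ {v : 𝒜 1} {U : Submodule k (𝒜 2)}, (∀ i, linMul 𝒜 v (b i) ∈ U) →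
      range (linMul 𝒜 v) ≤ U := by
    intro v U hU
    rw [range_eq_map, ← b.span_eq, Submodule.map_span, Submodule.span_le]
    rintro _ ⟨_, ⟨i, rfl⟩, rfl⟩
    exact hU i
  -- The indices come from the basis vectors, whose images span the ranges. The excluded values rule
  -- themselves out: x² = 0, while yx and y² lie in `range (linMul 𝒜 x)`.
  obtain ⟨i, hi⟩ : ∃ i, linMul 𝒜 x (b i) ≠ 0 := by
    by_contra! h0
    have : range (linMul 𝒜 x) ≤ ⊥ := hrange h0
    rw [le_bot_iff.1 this, finrank_bot] at hr
    omega
  obtain ⟨j, hj⟩ : ∃ j, linMul 𝒜 y (b j) ∉ range (linMul 𝒜 x) := by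
    by_contra! h0
    rw [sup_eq_left.2 (hrange h0)] at hr2
    omega
  have hspan := range_eq_span_of_finrank_one hr hi
  have hspan2 : range (linMul 𝒜 x) ⊔ range (linMul 𝒜 y) =
      Submodule.span k {linMul 𝒜 x (b i), linMul 𝒜 y (b j)} := by
    have hfin : FiniteDimensional k ↥(range (linMul 𝒜 x) ⊔ range (linMul 𝒜 y)) :=
      FiniteDimensional.of_finrank_pos (by omega)
    refine (Submodule.eq_of_le_of_finrank_le ?_ ?_).symm
    · rw [Submodule.span_le]
      rintro _ (rfl | rfl)
      · exact Submodule.mem_sup_left ⟨_, rfl⟩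
      · exact Submodule.mem_sup_right ⟨_, rfl⟩
    · have hli2 : LinearIndependent k ![linMul 𝒜 x (b i), linMul 𝒜 y (b j)] := by
        rw [LinearIndependent.pair_iff' hi]
        intro a ha
        exact hj ⟨a • b i, by rw [map_smul, ha]⟩
      have := finrank_span_eq_card hli2
      rw [Matrix.range_cons_cons_empty, Fintype.card_fin] at this
      rw [this, hr2]
  refine ⟨e, b, by omega, by omega, by omega, ?_⟩
  simp only [hb0, hb1, hb2, pow_two (x : R), pow_two (y : R), pow_two (z : R)]
  refine ⟨?_, mul_eq_zero_of hxx, h.mul_mem_iff.2 hyy, ?_, i, j, ?_, ?_, ?_,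
    h.span_mul_eq_singleton hspan, ?_, ?_⟩
  · rw [h.span_mul_maxIdeal, h.span_mul_maxIdeal, h.span_mul_maxIdeal, ← quadIdeal_sup,
      ← quadIdeal_sup, htop, h.maxIdeal_sq]
  · rw [h.span_pair_mul_maxIdeal]
    exact coe_mem_quadIdeal hzz
  · rintro rfl
    exact hi (by rw [hb0, hxx])
  · rintro rfl
    exact hj ⟨y, by rw [hb0, linMul_symm]⟩
  · rintro rfl
    exact hj (by rwa [hb1])
  · rw [h.span_pair_mul_maxIdeal, hspan2, quadIdeal_span, Set.image_pair, coe_linMul, coe_linMul]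
  · rw [← h.span_mul_eq_singleton hspan, h.mul_mem_iff]
    exact hj

theorem upToChange_cond8 (hf : Form8 (linMul 𝒜)) : UpToChange 𝒜 (Cond8 (maxIdeal 𝒜)) := by
  have := h.finite_one
  obtain ⟨x, y, hli, hxy, hx, hy⟩ := hf
  obtain ⟨e, b, he, hb⟩ := exists_basis_extending hli
  have hb0 : b ⟨0, by omega⟩ = x := hb 0
  have hb1 : b ⟨1, by omega⟩ = y := hb 1
  refine ⟨e, b, by omega, by omega, ?_⟩
  simp only [hb0, hb1]
  exact ⟨h.sq_eq_of_range_eq_top hx, h.sq_eq_of_range_eq_top hy, mul_eq_zero_of hxy⟩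

end IsStandardGraded
end Translation
-- Three quadrics in three variables without common zero form a regular sequence.
section RegularSequences
open MvPolynomial

variable {k : Type u} [Field k]

/-- If the divisor is nonconstant, its cofactor has degree at most one and no constant term;
comparing linear coefficients of the product then kills the cofactor. -/
theorem isUnit_of_dvd_of_isHomogeneous_two {σ : Type*} [DecidableEq σ] {f d : MvPolynomial σ k}
    (hf : f.IsHomogeneous 2)
    (hf0 : f ≠ 0) (hd : d ∣ f) (hc : constantCoeff d ≠ 0) : IsUnit d := by
  obtain ⟨g, rfl⟩ := hd
  have hd0 : d ≠ 0 := left_ne_zero_of_mul hf0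
  have hg0 : g ≠ 0 := right_ne_zero_of_mul hf0
  have hdeg := totalDegree_mul_of_isDomain hd0 hg0
  rw [hf.totalDegree hf0] at hdeg
  rw [isUnit_iff_totalDegree_of_isReduced]
  refine ⟨isUnit_iff_ne_zero.2 hc, ?_⟩
  by_contra hpos
  have h0 : coeff 0 g = 0 := by
    have := hf.coeff_eq_zero (d := 0) (by simp)
    rw [← constantCoeff_eq, map_mul] at this
    exact (mul_eq_zero.1 this).resolve_left hc
  refine hg0 (MvPolynomial.ext _ _ fun m => ?_)
  rw [coeff_zero]
  by_contra hm
  have hle : m.degree ≤ g.totalDegree := le_totalDegree (mem_support_iff.2 hm)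
  have hm0 : m ≠ 0 := by rintro rfl; exact hm h0
  have hm1 : m.degree = 1 := by
    have : m.degree ≠ 0 := by simpa [Finsupp.degree_eq_zero_iff] using hm0
    omega
  obtain ⟨i, rfl⟩ := (Finsupp.sum_eq_one_iff m).1 hm1
  have := hf.coeff_eq_zero (d := Finsupp.single i 1) (by simp)
  rw [coeff_mul, Finsupp.antidiagonal_single, Finset.sum_map, Finset.Nat.antidiagonal_succ] at this
  simp [h0] at this
  exact this.elim hc hm

/-- Without socle, nothing nonzero modulo `I` is killed by powers of all the variables: lower one
exponent at a time, by induction on their sum. -/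
theorem mem_of_X_pow_mul_mem {n : ℕ} {I : Ideal (MvPolynomial (Fin n) k)}
    (hI : ∀ g, (∀ i, X i * g ∈ I) → g ∈ I) (N : Fin n → ℕ) (g : MvPolynomial (Fin n) k)
    (hg : ∀ i, X i ^ N i * g ∈ I) : g ∈ I := by
  induction hs : ∑ i, N i using Nat.strong_induction_on generalizing N g with
  | _ s ih =>
    by_cases h0 : ∃ i, N i = 0
    · obtain ⟨i, hi⟩ := h0
      simpa [hi] using hg i
    push Not at h0
    refine hI g fun i => ?_
    refine ih (∑ j, Function.update N i (N i - 1) j) ?_ _ _ (fun j => ?_) rfl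
    · rw [← hs]
      refine Finset.sum_lt_sum (fun j _ => ?_) ⟨i, Finset.mem_univ _, ?_⟩
      · rcases eq_or_ne j i with rfl | hj
        · simp
        · simp [hj]
      · have := h0 i
        simp
        omega
    · rcases eq_or_ne j i with rfl | hj
      · rw [Function.update_self, ← mul_assoc, ← pow_succ, Nat.sub_add_cancel
          (Nat.one_le_iff_ne_zero.2 (h0 j))]
        exact hg j
      · rw [Function.update_of_ne hj, mul_left_comm]
        exact Ideal.mul_mem_left _ _ (hg j)

theorem mem_span_X_of_mul_mem {h : MvPolynomial (Fin 3) k}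
    (hh : X 2 * h ∈ Ideal.span {(X 0 : MvPolynomial (Fin 3) k), X 1}) :
    h ∈ Ideal.span {(X 0 : MvPolynomial (Fin 3) k), X 1} := by
  have hX : ({X 0, X 1} : Set (MvPolynomial (Fin 3) k)) = X '' {0, 1} := by rw [Set.image_pair]
  rw [hX, mem_ideal_span_X_image] at hh ⊢
  intro m hm
  obtain ⟨i, hi, him⟩ := hh (Finsupp.single 2 1 + m) (by
    rw [mem_support_iff, coeff_X_mul]
    exact mem_support_iff.1 hm)
  refine ⟨i, hi, ?_⟩
  rcases hi with rfl | rfl <;> simpa using him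

/-- The quotient of `k[X₀, X₁, X₂]` by two coprime polynomials has no socle. -/
theorem mem_span_pair_of_X_mul_mem {f₁ f₂ g : MvPolynomial (Fin 3) k} (hf : f₂ ≠ 0)
    (hcop : IsRelPrime f₁ f₂) (hg : ∀ i, X i * g ∈ Ideal.span {f₁, f₂}) :
    g ∈ Ideal.span {f₁, f₂} := by
  simp only [Ideal.mem_span_pair] at hg ⊢
  choose a b hab using hg
  -- A Koszul argument: coprimality shows that the representations of the X_i g differ by multiples
  -- of the trivial relation. The multipliers `h i j` satisfy a syzygy with the variables, which
  -- puts `h 0 1` into (X₀, X₁); the coefficients of X₀ g can then be corrected to be divisible by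
  -- X₀.
  have hdvd : ∀ i j, ∃ h, X i * a j - X j * a i = f₂ * h := fun i j => by
    refine hcop.symm.dvd_of_dvd_mul_right ⟨X j * b i - X i * b j, ?_⟩
    linear_combination X i * hab j - X j * hab i
  choose h hh using hdvd
  have hb : ∀ i j, X i * b j - X j * b i = -(f₁ * h i j) := fun i j => by
    apply mul_left_cancel₀ hf
    linear_combination X i * hab j - X j * hab i - f₁ * hh i j
  have hsyz : X 0 * h 1 2 + X 1 * h 2 0 + X 2 * h 0 1 = 0 := by
    apply mul_left_cancel₀ hf
    linear_combination -(X 0 * hh 1 2 + X 1 * hh 2 0 + X 2 * hh 0 1)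
  obtain ⟨p, q, hpq⟩ := Ideal.mem_span_pair.1 (mem_span_X_of_mul_mem (h := h 0 1)
    (Ideal.mem_span_pair.2 ⟨-h 1 2, -h 2 0, by linear_combination -hsyz⟩))
  have hX01 : ∀ {r s : MvPolynomial (Fin 3) k}, X 0 * r = X 1 * s → X 0 ∣ s := fun {r s} hrs =>
    (X_prime.dvd_or_dvd (Dvd.intro _ hrs)).resolve_left fun hd => by
      rw [X_dvd_X] at hd
      simp at hd
  obtain ⟨c, hc⟩ := hX01 (r := a 1 - p * f₂) (s := a 0 + q * f₂) (by
    linear_combination hh 0 1 - f₂ * hpq)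
  obtain ⟨d, hd⟩ := hX01 (r := b 1 + p * f₁) (s := b 0 - q * f₁) (by
    linear_combination hb 0 1 + f₁ * hpq)
  refine ⟨c, d, mul_left_cancel₀ (X_ne_zero (0 : Fin 3)) ?_⟩
  linear_combination hab 0 - f₁ * hc - f₂ * hd

/-- Any two polynomials without constant term share a nonzero zero, so `f₁` and `f₂` are nonzero,
and a nonunit common factor would yield a common zero with `f₃`. Thus `f₁, f₂` are coprime and have
no socle in their quotient, while powers of all variables lie in (f₁, f₂, f₃), so an element killed
by `f₃` modulo (f₁, f₂) is zero there. -/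
theorem isRegular_of_no_common_zero [IsAlgClosed k] {f₁ f₂ f₃ : MvPolynomial (Fin 3) k}
    (h₁ : f₁.IsHomogeneous 2) (h₂ : f₂.IsHomogeneous 2) (h₃ : f₃.IsHomogeneous 2)
    (hzero : ∀ x : Fin 3 → k, aeval x f₁ = 0 → aeval x f₂ = 0 → aeval x f₃ = 0 → x = 0) :
    RingTheory.Sequence.IsRegular (MvPolynomial (Fin 3) k) [f₁, f₂, f₃] := by
  have hcc : ∀ {f : MvPolynomial (Fin 3) k}, f.IsHomogeneous 2 → constantCoeff f = 0 :=
    fun hf => by rw [constantCoeff_eq]; exact hf.coeff_eq_zero (by simp)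
  have htwo : ∀ g g' : MvPolynomial (Fin 3) k, constantCoeff g = 0 → constantCoeff g' = 0 →
      ∃ x : Fin 3 → k, x ≠ 0 ∧ aeval x g = 0 ∧ aeval x g' = 0 := by
    intro g g' hg hg'
    obtain ⟨x, hx0, hx⟩ := exists_ne_zero_common_zero (n := 3) (ι := Fin 2) (by simp) ![g, g']
      (by intro i; fin_cases i <;> simp [hg, hg'])
    exact ⟨x, hx0, hx 0, hx 1⟩
  have hf₁ : f₁ ≠ 0 := by
    rintro rfl
    obtain ⟨x, hx0, hx, hx'⟩ := htwo f₂ f₃ (hcc h₂) (hcc h₃)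
    exact hx0 (hzero x (by simp) hx hx')
  have hf₂ : f₂ ≠ 0 := by
    rintro rfl
    obtain ⟨x, hx0, hx, hx'⟩ := htwo f₁ f₃ (hcc h₁) (hcc h₃)
    exact hx0 (hzero x hx (by simp) hx')
  have hcop : IsRelPrime f₁ f₂ := by
    intro d hd₁ hd₂
    refine isUnit_of_dvd_of_isHomogeneous_two h₁ hf₁ hd₁ fun hd => ?_
    obtain ⟨x, hx0, hx, hx'⟩ := htwo d f₃ hd (hcc h₃)
    have hz : ∀ {f}, d ∣ f → aeval x f = 0 := fun ⟨g, hg⟩ => by rw [hg, map_mul, hx, zero_mul]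
    exact hx0 (hzero x (hz hd₁) (hz hd₂) hx')
  have hpow : ∀ i, ∃ N : ℕ, (X i : MvPolynomial (Fin 3) k) ^ N ∈ Ideal.span {f₁, f₂, f₃} := by
    intro i
    change X i ∈ (Ideal.span {f₁, f₂, f₃}).radical
    rw [← vanishingIdeal_zeroLocus_eq_radical (K := k), mem_vanishingIdeal_iff]
    intro x hx
    rw [mem_zeroLocus_iff] at hx
    have hx' : ∀ f ∈ ({f₁, f₂, f₃} : Set (MvPolynomial (Fin 3) k)), aeval x f = 0 := fun f hf =>
      hx f (Ideal.subset_span hf)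
    rw [hzero x (hx' _ (by simp)) (hx' _ (by simp)) (hx' _ (by simp))]
    simp
  rw [RingTheory.Sequence.isRegular_iff, RingTheory.Sequence.isWeaklyRegular_iff_Fin]
  constructor
  · intro i
    rw [isSMulRegular_quotient_iff_mem_of_smul_mem]
    intro g hg
    fin_cases i
    · simpa [hf₁] using hg
    · change g ∈ Ideal.ofList [f₁] • (⊤ : Ideal (MvPolynomial (Fin 3) k))
      change f₂ * g ∈ Ideal.ofList [f₁] • (⊤ : Ideal (MvPolynomial (Fin 3) k)) at hg
      rw [smul_eq_mul, Ideal.mul_top, Ideal.ofList_singleton, Ideal.mem_span_singleton] at hg ⊢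
      exact hcop.dvd_of_dvd_mul_left hg
    · have hI : Ideal.ofList [f₁, f₂] • (⊤ : Ideal (MvPolynomial (Fin 3) k)) =
          Ideal.span {f₁, f₂} := by
        rw [smul_eq_mul, Ideal.mul_top, Ideal.ofList_cons, Ideal.ofList_singleton,
          Ideal.span_insert]
      change g ∈ Ideal.ofList [f₁, f₂] • (⊤ : Ideal (MvPolynomial (Fin 3) k))
      change f₃ * g ∈ Ideal.ofList [f₁, f₂] • (⊤ : Ideal (MvPolynomial (Fin 3) k)) at hg
      rw [hI] at hg ⊢
      choose N hN using hpow
      refine mem_of_X_pow_mul_mem (fun g hg => mem_span_pair_of_X_mul_mem hf₂ hcop hg) N g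
        fun i => ?_
      obtain ⟨a, c, hc, hac⟩ := Ideal.mem_span_insert.1 (hN i)
      obtain ⟨b, d, hd, hbd⟩ := Ideal.mem_span_insert.1 hc
      obtain ⟨e, rfl⟩ := Ideal.mem_span_singleton'.1 hd
      rw [hac, hbd]
      have : (a * f₁ + (b * f₂ + e * f₃)) * g = (a * g) * f₁ + (b * g) * f₂ + e * (f₃ * g) := by
        ring
      rw [this]
      exact add_mem (Ideal.mem_span_pair.2 ⟨_, _, rfl⟩) (Ideal.mul_mem_left _ _ hg)
  · intro htop
    have h1 : (1 : MvPolynomial (Fin 3) k) ∈ Ideal.ofList [f₁, f₂, f₃] := by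
      rw [smul_eq_mul, Ideal.mul_top] at htop
      rw [← htop]; trivial
    have hle : Ideal.ofList [f₁, f₂, f₃] ≤ RingHom.ker (constantCoeff (R := k) (σ := Fin 3)) := by
      rw [Ideal.ofList, Ideal.span_le]
      intro f hf
      have : f = f₁ ∨ f = f₂ ∨ f = f₃ := by simpa using hf
      rcases this with rfl | rfl | rfl
      · exact hcc h₁
      · exact hcc h₂
      · exact hcc h₃
    have := hle h1
    simp [RingHom.mem_ker] at this

end RegularSequences
-- Presenting a bilinear map by quadrics.
section Quadrics
open Module LinearMap

variable {k : Type u} [Field k]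

theorem homogeneousSubmodule_two_eq_span {σ : Type*} :
    MvPolynomial.homogeneousSubmodule σ k 2 = Submodule.span k
      (Set.range fun p : σ × σ => (MvPolynomial.X p.1 * MvPolynomial.X p.2 : MvPolynomial σ k)) := by
  rw [← MvPolynomial.homogeneousSubmodule_one_pow, MvPolynomial.homogeneousSubmodule_one_eq_span_X,
    pow_two, Submodule.span_mul_span]
  congr 1
  ext r
  simp [Set.mem_mul]

theorem ext_basis_of_le {C A : Type*} [AddCommGroup C] [Module k C] [AddCommGroup A] [Module k A]
    {ι : Type*} [LinearOrder ι] (b : Basis ι k C) {M N : C →ₗ[k] C →ₗ[k] A}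
    (hM : ∀ x y, M x y = M y x) (hN : ∀ x y, N x y = N y x)
    (h : ∀ i j, i ≤ j → M (b i) (b j) = N (b i) (b j)) : M = N := by
  refine b.ext fun i => b.ext fun j => ?_
  rcases le_total i j with hij | hij
  · exact h i j hij
  · rw [hM, hN, h j i hij]

variable {V W : Type*} [AddCommGroup V] [Module k V] [AddCommGroup W] [Module k W]

/-- A bilinear map with target of dimension `3` and radical of codimension `3` is governed by three
quadrics in three variables. -/
theorem exists_quadrics [FiniteDimensional k V] [FiniteDimensional k W]
    {B : V →ₗ[k] V →ₗ[k] W} (hsymm : ∀ x y, B x y = B y x)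
    (hspan : ∀ ψ : W →ₗ[k] k, (∀ x y, ψ (B x y) = 0) → ψ = 0)
    (hW : finrank k W = 3) (hV : finrank k (ker B) + 3 = finrank k V) :
    ∃ (c : Fin 3 → V) (f : Fin 3 → MvPolynomial (Fin 3) k), (∀ i, (f i).IsHomogeneous 2) ∧
      ker B ⊔ Submodule.span k (Set.range c) = ⊤ ∧
      (∀ (A : Type u) [CommRing A] [Algebra k A] (y : Fin 3 → A),
        (∀ i, MvPolynomial.aeval y (f i) = 0) → ∃ (π : V →ₗ[k] A) (ρ : W →ₗ[k] A),
          (∀ v w, ρ (B v w) = π v * π w) ∧ (∀ i, π (c i) = y i) ∧ ∀ v ∈ ker B, π v = 0) ∧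
      ∀ (A : Type v) [CommRing A] [Algebra k A] (π : V →ₗ[k] A) (ρ : W →ₗ[k] A),
        (∀ v w, ρ (B v w) = π v * π w) → ∀ i, MvPolynomial.aeval (fun j => π (c j)) (f i) = 0 := by
  obtain ⟨C, hC⟩ := Submodule.exists_isCompl (ker B)
  have hdim := Submodule.finrank_add_eq_of_isCompl hC
  let c := finBasisOfFinrankEq k C (by omega : finrank k C = 3)
  -- `P` indexes the six quadratic monomials. `E` evaluates them in W, `G` as polynomials; as `E` is
  -- onto, its kernel has dimension 6 - 3, and `G` turns a basis of it into the three quadrics.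
  let P := {p : Fin 3 × Fin 3 // p.1 ≤ p.2}
  let E : (P → k) →ₗ[k] W := Fintype.linearCombination k fun p : P => B (c p.1.1) (c p.1.2)
  let G : (P → k) →ₗ[k] MvPolynomial (Fin 3) k :=
    Fintype.linearCombination k fun p : P => MvPolynomial.X p.1.1 * MvPolynomial.X p.1.2
  let proj := C.projectionOnto (ker B) hC.symm
  have hBproj : ∀ v w, B v w = B (proj v) (proj w) := by
    have h1 : ∀ v, B v = B (proj v) := fun v => by
      rw [← sub_eq_zero, ← map_sub, ← mem_ker]
      have : proj (v - proj v) = 0 := by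
        rw [map_sub, Submodule.projectionOnto_apply_left, sub_self]
      rwa [← mem_ker, Submodule.ker_projectionOnto] at this
    intro v w
    rw [h1 v, hsymm, h1 w, hsymm]
  have hproj : ∀ x : C, proj x = x := Submodule.projectionOnto_apply_left _
  let BC : C →ₗ[k] C →ₗ[k] W := B.compl₁₂ C.subtype C.subtype
  have hE : ∀ i j (hij : i ≤ j), E (Pi.single ⟨(i, j), hij⟩ 1) = B (c i) (c j) := fun i j hij => by
    simp [E, Fintype.linearCombination_apply_single]
  have hEtop : range E = ⊤ := by
    by_contra hne
    obtain ⟨ψ, hψ, hle⟩ := Submodule.exists_le_ker_of_lt_top _ (lt_top_iff_ne_top.2 hne)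
    have h0 : BC.compr₂ ψ = 0 := by
      refine ext_basis_of_le c (fun x y => congrArg ψ (hsymm _ _)) (fun _ _ => rfl)
        fun i j hij => ?_
      change ψ (B (c i) (c j)) = 0
      rw [← hE i j hij]
      exact hle ⟨_, rfl⟩
    refine hψ (hspan ψ fun x y => ?_)
    rw [hBproj]
    exact congr($h0 (proj x) (proj y))
  have hkerE : finrank k (ker E) = 3 := by
    have h1 := finrank_range_add_finrank_ker E
    rw [hEtop, finrank_top, hW, finrank_fintype_fun_eq_card] at h1
    have : Fintype.card P = 6 := by decide
    omega
  let g := finBasisOfFinrankEq k (ker E) hkerE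
  refine ⟨fun i => c i, fun i => G (g i), fun i => ?_, ?_, ?_, ?_⟩
  · simp only [G, Fintype.linearCombination_apply]
    refine MvPolynomial.IsHomogeneous.sum _ _ _ fun p _ => ?_
    rw [MvPolynomial.smul_eq_C_mul]
    exact ((MvPolynomial.isHomogeneous_X _ _).mul (MvPolynomial.isHomogeneous_X _ _)).C_mul _
  · have : Submodule.span k (Set.range fun i => (c i : V)) = C := by
      have h1 := congrArg (Submodule.map C.subtype) c.span_eq
      rw [Submodule.map_span, ← Set.range_comp, Submodule.map_subtype_top] at h1
      exact h1
    rw [this, hC.sup_eq_top]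
  · intro A _ _ y hy
    -- Evaluation at `y` kills ker `E`, so it descends along `E` to W; the section `s` realizes the
    -- descended map.
    obtain ⟨s, hs⟩ := exists_rightInverse_of_surjective E hEtop
    let L : (P → k) →ₗ[k] A := (MvPolynomial.aeval y).toLinearMap ∘ₗ G
    have hL : ∀ a ∈ ker E, L a = 0 := by
      have : L ∘ₗ (ker E).subtype = 0 := g.ext fun i => hy i
      exact fun a ha => congr($this ⟨a, ha⟩)
    have hρ : ∀ a, L (s (E a)) = L a := fun a => by
      rw [← sub_eq_zero, ← map_sub]
      refine hL _ ?_
      rw [mem_ker, map_sub, sub_eq_zero]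
      exact congr($hs (E a))
    let πC : C →ₗ[k] A := c.constr k y
    have hπC : ∀ i, πC (c i) = y i := fun i => c.constr_basis k y i
    have hmul : BC.compr₂ (L ∘ₗ s) = (LinearMap.mul k A).compl₁₂ πC πC := by
      refine ext_basis_of_le c (fun x y => congrArg (L ∘ₗ s) (hsymm _ _))
        (fun x y => mul_comm (πC x) (πC y)) fun i j hij => ?_
      change L (s (B (c i) (c j))) = πC (c i) * πC (c j)
      rw [← hE i j hij, hρ, hπC, hπC]
      simp [L, G, Fintype.linearCombination_apply_single]
    refine ⟨πC ∘ₗ proj, L ∘ₗ s, fun v w => ?_, fun i => ?_, fun v hv => ?_⟩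
    · rw [hBproj]
      exact congr($hmul (proj v) (proj w))
    · change πC (proj (c i)) = y i
      rw [hproj, hπC]
    · change πC (proj v) = 0
      rw [(Submodule.projectionOnto_apply_eq_zero_iff hC.symm).2 hv, map_zero]
  · intro A _ _ π ρ h i
    have h1 : ∀ a, MvPolynomial.aeval (fun j => π (c j)) (G a) = ρ (E a) := fun a => by
      simp [G, E, Fintype.linearCombination_apply, h]
    rw [h1, (g i).2, map_zero]

end Quadrics
-- Quadratic algebras: maps out of them, admissibility, and complete intersections.
section Quadratic
open Module LinearMap

variable {k : Type u} {R : Type v} [Field k] [CommRing R] [Algebra k R]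
variable {𝒜 : ℕ → Submodule k R} [GradedAlgebra 𝒜]

theorem IsStandardGraded.one_le_span (h : IsStandardGraded 𝒜) {e : ℕ} {x : Fin e → R}
    (hx : ∀ i, x i ∈ 𝒜 1)
    (hsurj : Function.Surjective (MvPolynomial.aeval x : MvPolynomial (Fin e) k →ₐ[k] R)) :
    𝒜 1 ≤ Submodule.span k (Set.range x) := by
  have key : ∀ p : MvPolynomial (Fin e) k,
      (DirectSum.decompose 𝒜 (MvPolynomial.aeval x p) 1 : R) ∈ Submodule.span k (Set.range x) := by
    intro p
    induction p using MvPolynomial.induction_on with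
    | C a =>
      have h0 : algebraMap k R a ∈ 𝒜 0 := by
        rw [h.zero_eq]
        exact Submodule.algebraMap_mem a
      rw [MvPolynomial.aeval_C, DirectSum.decompose_of_mem_ne 𝒜 h0 (by decide)]
      exact zero_mem _
    | add p q hp hq =>
      rw [map_add, DirectSum.decompose_add]
      exact add_mem hp hq
    | mul_X p i _ =>
      obtain ⟨c, hc⟩ := h.exists_algebraMap_eq (DirectSum.decompose 𝒜 (MvPolynomial.aeval x p) 0).2
      have h1 := DirectSum.coe_decompose_mul_add_of_right_mem 𝒜 (i := 0)
        (a := MvPolynomial.aeval x p) (hx i)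
      rw [zero_add, ← hc, ← Algebra.smul_def] at h1
      rw [map_mul, MvPolynomial.aeval_X, h1]
      exact Submodule.smul_mem _ c (Submodule.subset_span ⟨i, rfl⟩)
  intro v hv
  obtain ⟨p, rfl⟩ := hsurj v
  have := key p
  rwa [DirectSum.decompose_of_mem_same 𝒜 hv] at this

/-- Algebra homomorphisms out of a quadratic algebra are determined by compatible linear maps in
degrees one and two. -/
theorem IsQuadratic.exists_algHom (hq : IsQuadratic 𝒜) (h : IsStandardGraded 𝒜) {A : Type*}
    [CommRing A] [Algebra k A] (π : 𝒜 1 →ₗ[k] A) (ρ : 𝒜 2 →ₗ[k] A)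
    (hπ : ∀ v w, ρ (linMul 𝒜 v w) = π v * π w) : ∃ Θ : R →ₐ[k] A, ∀ v : 𝒜 1, Θ v = π v := by
  obtain ⟨e, x, S, hx, hsurj, hS, hker⟩ := hq
  let Φ : MvPolynomial (Fin e) k →ₐ[k] A := MvPolynomial.aeval fun i => π ⟨x i, hx i⟩
  have htwo : ∀ f ∈ MvPolynomial.homogeneousSubmodule (Fin e) k 2,
      ∃ w : 𝒜 2, (w : R) = MvPolynomial.aeval x f ∧ ρ w = Φ f := by
    intro f hf
    rw [homogeneousSubmodule_two_eq_span] at hf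
    induction hf using Submodule.span_induction with
    | mem f hf =>
      obtain ⟨p, rfl⟩ := hf
      exact ⟨linMul 𝒜 ⟨x p.1, hx _⟩ ⟨x p.2, hx _⟩, by simp, by simp [hπ, Φ]⟩
    | zero => exact ⟨0, by simp, by simp⟩
    | add f g _ _ hf hg =>
      obtain ⟨w, hw, hw'⟩ := hf
      obtain ⟨z, hz, hz'⟩ := hg
      exact ⟨w + z, by simp [hw, hz], by simp [hw', hz']⟩
    | smul a f _ hf =>
      obtain ⟨w, hw, hw'⟩ := hf
      exact ⟨a • w, by simp [hw], by simp [hw']⟩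
  have hle : RingHom.ker (MvPolynomial.aeval x : MvPolynomial (Fin e) k →ₐ[k] R).toRingHom ≤
      RingHom.ker Φ.toRingHom := by
    change RingHom.ker (MvPolynomial.aeval x : MvPolynomial (Fin e) k →ₐ[k] R) ≤ RingHom.ker Φ
    rw [hker, Ideal.span_le]
    intro f hf
    obtain ⟨w, hw, hw'⟩ := htwo f (hS f hf)
    have h0 : MvPolynomial.aeval x f = 0 := by
      have : f ∈ RingHom.ker (MvPolynomial.aeval x : MvPolynomial (Fin e) k →ₐ[k] R) :=
        hker ▸ Ideal.subset_span hf
      exact this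
    rw [h0, Submodule.coe_eq_zero] at hw
    rw [hw, map_zero] at hw'
    exact hw'.symm
  let Θ := AlgHom.liftOfSurjective _ hsurj Φ hle
  have hΘ : ∀ p, Θ (MvPolynomial.aeval x p) = Φ p := fun p =>
    AlgHom.liftOfSurjective_apply _ hsurj Φ hle p
  have hspan := h.one_le_span hx hsurj
  refine ⟨Θ, fun v => ?_⟩
  suffices ∀ r ∈ Submodule.span k (Set.range x), ∃ hr : r ∈ 𝒜 1, Θ r = π ⟨r, hr⟩ by
    obtain ⟨_, h'⟩ := this v (hspan v.2)
    exact h'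
  intro r hr
  induction hr using Submodule.span_induction with
  | mem r hr =>
    obtain ⟨i, rfl⟩ := hr
    refine ⟨hx i, ?_⟩
    have := hΘ (MvPolynomial.X i)
    simpa [Φ] using this
  | zero => exact ⟨zero_mem _, by rw [map_zero]; exact (map_zero π).symm⟩
  | add a b _ _ ha hb =>
    obtain ⟨ha, ha'⟩ := ha
    obtain ⟨hb, hb'⟩ := hb
    exact ⟨add_mem ha hb, by rw [map_add, ha', hb', ← map_add]; rfl⟩
  | smul c a _ ha =>
    obtain ⟨ha, ha'⟩ := ha
    exact ⟨Submodule.smul_mem _ c ha, by rw [map_smul, ha', ← map_smul]; rfl⟩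

/-- The descending chain of powers stabilizes, giving xⁿ = xⁿ⁺¹y; the right side has no component in
degree n. -/
theorem isNilpotent_of_mem_one [IsArtinianRing R] {x : R} (hx : x ∈ 𝒜 1) : IsNilpotent x := by
  obtain ⟨n, y, hy⟩ := IsArtinian.exists_pow_succ_smul_dvd x (1 : R)
  refine ⟨n, ?_⟩
  have h1 : x ^ n ∈ 𝒜 n := by simpa using SetLike.pow_mem_graded n hx
  have h2 : x ^ (n + 1) ∈ 𝒜 (n + 1) := by simpa using SetLike.pow_mem_graded (n + 1) hx
  have h3 : x ^ (n + 1) * y = x ^ n := by simpa using hy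
  have h4 := DirectSum.coe_decompose_mul_of_left_mem_of_not_le 𝒜 (b := y) (n := n) h2 (by omega)
  rwa [h3, DirectSum.decompose_of_mem_same 𝒜 h1] at h4

theorem IsQuadratic.admissible (hq : IsQuadratic 𝒜) (h : IsStandardGraded 𝒜) [IsArtinianRing R] :
    Admissible (linMul 𝒜) where
  symm := linMul_symm
  eq_zero_of_forall := h.eq_zero_of_forall
  eq_zero_of_mul φ ψ hφ := by
    obtain ⟨Θ, hΘ⟩ := hq.exists_algHom h φ ψ hφ
    ext v
    rw [← hΘ]
    exact ((isNilpotent_of_mem_one v.2).map Θ).eq_zero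

/-- The radical linear forms generate the ideal to be divided out. A common zero of the three
quadrics is a pair (φ, ψ) forbidden by admissibility, which gives regularity. That they generate all
relations follows from a map in the other direction, from R to the polynomial ring modulo the
quadrics, supplied by quadraticity. -/
theorem IsQuadratic.isTrivialFiberExtensionOfCI [IsAlgClosed k] (hq : IsQuadratic 𝒜)
    (h : IsStandardGraded 𝒜) (hB : Admissible (linMul 𝒜)) (hW : finrank k (𝒜 2) = 3)
    (hV : finrank k (ker (linMul 𝒜)) + 3 = finrank k (𝒜 1)) : IsTrivialFiberExtensionOfCI 𝒜 3 := by
  have := h.finite_one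
  have : FiniteDimensional k (𝒜 2) := FiniteDimensional.of_finrank_pos (by omega)
  obtain ⟨c, f, hf, hc, hfac, hval⟩ :=
    exists_quadrics.{u, v} linMul_symm h.eq_zero_of_forall hW hV
  let J : Ideal R := Ideal.span (Subtype.val '' (ker (linMul 𝒜) : Set (𝒜 1)))
  have hkerJ : ∀ v ∈ ker (linMul 𝒜), (v : R) ∈ J := fun v hv => Ideal.subset_span ⟨v, hv, rfl⟩
  obtain ⟨n, w, hw⟩ := Submodule.fg_iff_exists_fin_generating_family.1
    (IsNoetherian.noetherian (ker (linMul 𝒜)))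
  have hwk : ∀ i, w i ∈ ker (linMul 𝒜) := fun i => hw ▸ Submodule.subset_span ⟨i, rfl⟩
  refine ⟨J, ⟨n, fun i => w i, fun i => (w i).2, fun i r hr => ?_, ?_⟩, ?_⟩
  · exact congrArg Subtype.val congr($(hwk i) ⟨r, hr⟩)
  · apply le_antisymm
    · rw [Ideal.span_le]
      rintro _ ⟨v, hv, rfl⟩
      rw [← hw] at hv
      induction hv using Submodule.span_induction with
      | mem v hv =>
        obtain ⟨i, rfl⟩ := hv
        exact Ideal.subset_span ⟨i, rfl⟩
      | zero => simp
      | add a b _ _ ha hb => exact add_mem ha hb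
      | smul a b _ hb => exact Submodule.smul_of_tower_mem _ a hb
    · rw [Ideal.span_le]
      rintro _ ⟨i, rfl⟩
      exact hkerJ _ (hwk i)
  let mk : R →ₐ[k] R ⧸ J := Ideal.Quotient.mkₐ k J
  have hmk : ∀ p : MvPolynomial (Fin 3) k, MvPolynomial.aeval (fun i => mk (c i)) p =
      mk (MvPolynomial.aeval (fun i => (c i : R)) p) := fun p => by
    rw [← AlgHom.comp_apply, MvPolynomial.comp_aeval]
  have hzero : ∀ i, MvPolynomial.aeval (fun i => (c i : R)) (f i) = 0 := fun i =>
    hval R (𝒜 1).subtype (𝒜 2).subtype (fun _ _ => rfl) i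
  refine ⟨fun i => mk (c i), [f 0, f 1, f 2], fun i => ⟨c i, (c i).2, rfl⟩, ?_, ?_, ?_, ?_⟩
  · have htop : (MvPolynomial.aeval (fun i => mk (c i)) :
        MvPolynomial (Fin 3) k →ₐ[k] R ⧸ J).range.comap mk = ⊤ := by
      rw [eq_top_iff, ← h.generated, Algebra.adjoin_le_iff]
      intro v hv
      have hv' : (⟨v, hv⟩ : 𝒜 1) ∈ ker (linMul 𝒜) ⊔ Submodule.span k (Set.range c) := hc ▸ trivial
      obtain ⟨r, hr, s, hs, hrs⟩ := Submodule.mem_sup.1 hv'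
      have hv : v = r + s := (congrArg Subtype.val hrs).symm
      have hr0 : mk r = 0 := Ideal.Quotient.eq_zero_iff_mem.2 (hkerJ r hr)
      change mk v ∈ AlgHom.range _
      rw [hv, map_add, hr0, zero_add]
      clear hrs hv hv'
      induction hs using Submodule.span_induction with
      | mem s hs =>
        obtain ⟨i, rfl⟩ := hs
        exact ⟨MvPolynomial.X i, MvPolynomial.aeval_X _ _⟩
      | zero => simp
      | add a b _ _ ha hb =>
        rw [Submodule.coe_add, map_add]
        exact add_mem ha hb
      | smul a b _ hb =>
        rw [Submodule.coe_smul, map_smul]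
        exact Subalgebra.smul_mem _ hb a
    intro r
    obtain ⟨r, rfl⟩ := Ideal.Quotient.mkₐ_surjective k J r
    have : r ∈ (MvPolynomial.aeval (fun i => mk (c i)) :
        MvPolynomial (Fin 3) k →ₐ[k] R ⧸ J).range.comap mk := htop ▸ trivial
    exact this
  · intro g hg
    have : g = f 0 ∨ g = f 1 ∨ g = f 2 := by simpa using hg
    rcases this with rfl | rfl | rfl <;> exact ⟨2, le_rfl, hf _⟩
  · refine isRegular_of_no_common_zero (hf 0) (hf 1) (hf 2) fun y h0 h1 h2 => ?_
    obtain ⟨φ, ψ, hφ, hy, -⟩ := hfac k y (by intro i; fin_cases i <;> assumption)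
    have := hB.eq_zero_of_mul φ ψ hφ
    ext i
    rw [← hy, this]
    rfl
  · have hofList : Ideal.ofList [f 0, f 1, f 2] = Ideal.span (Set.range f) := by
      rw [Ideal.ofList]
      congr 1
      ext g
      simp [Fin.exists_fin_succ, eq_comm]
    rw [hofList]
    apply le_antisymm
    · intro p hp
      have hp' : mk (MvPolynomial.aeval (fun i => (c i : R)) p) = 0 := by
        rw [← hmk]; exact hp
      let q := Ideal.Quotient.mkₐ k (Ideal.span (Set.range f))
      have hq0 : ∀ p, MvPolynomial.aeval (fun i => q (MvPolynomial.X i)) p = q p := fun p => by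
        have := MvPolynomial.comp_aeval (R := k) (MvPolynomial.X : Fin 3 → MvPolynomial (Fin 3) k) q
        rw [← this, AlgHom.comp_apply, MvPolynomial.aeval_X_left_apply]
      obtain ⟨π, ρ, hπ, hπc, hπ0⟩ := hfac _ (fun i => q (MvPolynomial.X i)) fun i => by
        rw [hq0]
        exact Ideal.Quotient.eq_zero_iff_mem.2 (Ideal.subset_span ⟨i, rfl⟩)
      obtain ⟨Θ, hΘ⟩ := hq.exists_algHom h π ρ hπ
      have hJ : J ≤ RingHom.ker Θ := by
        rw [Ideal.span_le]
        rintro _ ⟨v, hv, rfl⟩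
        change Θ v = 0
        rw [hΘ, hπ0 v hv]
      have h1 : Θ (MvPolynomial.aeval (fun i => (c i : R)) p) = 0 :=
        hJ (Ideal.Quotient.eq_zero_iff_mem.1 hp')
      rw [← AlgHom.comp_apply, MvPolynomial.comp_aeval] at h1
      have h2 : (fun i => Θ (c i : R)) = fun i => q (MvPolynomial.X i) := by
        ext1 i
        rw [hΘ, hπc]
      rw [h2, hq0] at h1
      exact Ideal.Quotient.eq_zero_iff_mem.1 h1
    · rw [Ideal.span_le]
      rintro _ ⟨i, rfl⟩
      change MvPolynomial.aeval (fun i => mk (c i)) (f i) = 0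
      rw [hmk, hzero, map_zero]

end Quadratic
end QuadAlg

theorem mainTheorem12 {k : Type u} {R : Type v} [Field k] [IsAlgClosed k]
    [CommRing R] [Algebra k R] (𝒜 : ℕ → Submodule k R) [GradedAlgebra 𝒜]
    (hstd : QuadAlg.IsStandardGraded 𝒜) (hquad : QuadAlg.IsQuadratic 𝒜)
    (hart : IsArtinianRing R) :
    (Module.finrank k (𝒜 2) = 1 →
      QuadAlg.UpToChange 𝒜 (QuadAlg.Cond1 (QuadAlg.maxIdeal 𝒜))) ∧
    (Module.finrank k (𝒜 2) = 2 →
      QuadAlg.UpToChange 𝒜 (QuadAlg.Cond1 (QuadAlg.maxIdeal 𝒜)) ∨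
      QuadAlg.UpToChange 𝒜 (QuadAlg.Cond2 (QuadAlg.maxIdeal 𝒜))) ∧
    (Module.finrank k (𝒜 2) = 3 →
      (QuadAlg.UpToChange 𝒜 (QuadAlg.Cond1 (QuadAlg.maxIdeal 𝒜)) ∨
       QuadAlg.UpToChange 𝒜 (QuadAlg.Cond2 (QuadAlg.maxIdeal 𝒜)) ∨
       QuadAlg.UpToChange 𝒜 (QuadAlg.Cond3 (QuadAlg.maxIdeal 𝒜)) ∨
       QuadAlg.UpToChange 𝒜 (QuadAlg.Cond4 (QuadAlg.maxIdeal 𝒜)) ∨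
       QuadAlg.UpToChange 𝒜 (QuadAlg.Cond5 (QuadAlg.maxIdeal 𝒜)) ∨
       QuadAlg.UpToChange 𝒜 (QuadAlg.Cond6 (QuadAlg.maxIdeal 𝒜)) ∨
       QuadAlg.UpToChange 𝒜 (QuadAlg.Cond7 (QuadAlg.maxIdeal 𝒜)) ∨
       QuadAlg.UpToChange 𝒜 (QuadAlg.Cond8 (QuadAlg.maxIdeal 𝒜))) ∨
      QuadAlg.IsTrivialFiberExtensionOfCI 𝒜 3) := by
  have hfin1 := hstd.finite_one
  have hB := hquad.admissible hstd
  refine ⟨fun hW => ?_, fun hW => ?_, fun hW => ?_⟩ <;>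
  have hfin2 : FiniteDimensional k (𝒜 2) := FiniteDimensional.of_finrank_pos (by omega) <;>
  have hnt : Nontrivial (𝒜 2) := Module.nontrivial_of_finrank_pos (R := k) (by omega)
  · exact hstd.upToChange_cond1 (hB.exists_range_eq_top_of_finrank_eq_one hW)
  · exact (hB.form1_or_form2 hW).imp hstd.upToChange_cond1 hstd.upToChange_cond2
  -- The codimension of the radical is at least 3 in any case; exactly 3 gives the complete
  -- intersection, 4 or more the eight conditions.
  · rcases Nat.lt_or_ge (Module.finrank k (𝒜 1))
      (Module.finrank k (LinearMap.ker (QuadAlg.linMul 𝒜)) + 4) with hlt | hge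
    · have hle := hB.three_le_codim (by omega)
      exact .inr (hquad.isTrivialFiberExtensionOfCI hstd hB hW (by omega))
    · exact .inl <| (hB.form_of_four_le_codim hW hge).imp hstd.upToChange_cond1 <|
        .imp hstd.upToChange_cond2 <| .imp hstd.upToChange_cond3 <|
        .imp hstd.upToChange_cond4 <| .imp hstd.upToChange_cond5 <|
        .imp hstd.upToChange_cond6 <| .imp hstd.upToChange_cond7 hstd.upToChange_cond8
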